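/- Let $m=(m_0,m_1,\dots)$ be a bounded sequence of integers $m_k\ge 2$, let $G_m=\prod_{k\ge 0}\mathbb{Z}/m_k\mathbb{Z}$ be the corresponding bounded Vilenkin group, with coordinates $x_k\in\{0,\dots,m_k-1\}$, and let $\mu$ be its normalized Haar measure, i.e. the product of the uniform probability measures on the factors. Put $M_0=1$, $M_{k+1}=m_kM_k$, write $n\in\mathbb{N}$ as $n=\sum_{k\ge 0} n_kM_k$ with $n_k\in\{0,\dots,m_k-1\}$, and let $$\psi_n(x)=\prod_{k\ge 0}\exp\!\left(\frac{2\pi i\,x_k}{m_k}\right)^{n_k}\qquad(x\in G_m)$$ be the Vilenkin functions. For $f\in L_1(G_m\times G_m)$ (complex-valued, with respect to $\mu\times\mu$) let $$\widehat f(i,j)=\int_{G_m\times G_m} f(x,y)\,\overline{\psi_i(x)}\,\overline{\psi_j(y)}\,d(\mu\times\mu)(x,y),\qquad S_{M,N}(x,y;f)=\sum_{i=0}^{M-1}\sum_{j=0}^{N-1}\widehat f(i,j)\,\psi_i(x)\,\psi_j(y),$$ and, for $n\ge 1$, let $$\sigma_n(x,y;f)=\frac1n\sum_{j=0}^{n-1}S_{j,j}(x,y;f)$$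 be the Marcinkiewicz-Fejér means of $f$. Then for every $f\in L_1(G_m\times G_m)$, $$\lim_{n\to\infty}\sigma_n(x,y;f)=f(x,y)\qquad\text{for almost every }(x,y)\in G_m\times G_m.$$ -/

import Mathlib

open MeasureTheory Filter Topology
open scoped ENNReal ComplexConjugate

noncomputable section

namespace Vilenkin

/-- The Vilenkin group `G_m`: the complete direct product of the cyclic groups `ℤ / m_k`, with the
product group structure, product topology and product `σ`-algebra. -/
abbrev Group (m : ℕ → ℕ) : Type := (k : ℕ) → ZMod (m k)

/-- The measure on `ℤ / m_k` that gives mass `1 / m_k` to every point. -/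
def coordMeasure (m : ℕ → ℕ) (k : ℕ) : Measure (ZMod (m k)) :=
  ((m k : ℝ≥0∞)⁻¹) • Measure.count

instance (m : ℕ → ℕ) [∀ k, (m k).AtLeastTwo] (k : ℕ) :
    IsProbabilityMeasure (coordMeasure m k) := by
  constructor
  have h0 : (m k : ℝ≥0∞) ≠ 0 := Nat.cast_ne_zero.mpr (NeZero.ne (m k))
  rw [coordMeasure, Measure.smul_apply, Measure.count_univ, smul_eq_mul, ENat.card_eq_coe_natCard,
    Nat.card_zmod]
  simpa using ENNReal.inv_mul_cancel h0 (ENNReal.natCast_ne_top _)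

/-- The normalized Haar measure `μ` of `G_m`: the direct product of the uniform measures. -/
def haar (m : ℕ → ℕ) [∀ k, (m k).AtLeastTwo] : Measure (Group m) :=
  Measure.infinitePi (coordMeasure m)

/-- The generalized powers: `M_0 = 1`, `M_{k+1} = m_k M_k`. -/
def genPow (m : ℕ → ℕ) : ℕ → ℕ
  | 0 => 1
  | k + 1 => m k * genPow m k

/-- The `k`-th digit `n_k ∈ {0, …, m_k - 1}` of `n = ∑ k, n_k M_k`. -/
def digit (m : ℕ → ℕ) (n k : ℕ) : ℕ := n / genPow m k % m k

/-- The generalized Rademacher functions `r_k(x) = exp(2πi x_k / m_k)`. -/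
def rademacher (m : ℕ → ℕ) (k : ℕ) (x : Group m) : ℂ :=
  Complex.exp (2 * Real.pi * Complex.I * ((x k).val : ℂ) / (m k : ℂ))

/-- The Vilenkin functions `ψ_n = ∏ k, r_k ^ n_k`; only finitely many factors differ from `1`, see
`finite_mulSupport`. -/
def psi (m : ℕ → ℕ) (n : ℕ) (x : Group m) : ℂ :=
  ∏ᶠ k : ℕ, rademacher m k x ^ digit m n k

theorem lt_genPow (m : ℕ → ℕ) [∀ k, (m k).AtLeastTwo] (k : ℕ) : k < genPow m k := by
  induction k with
  | zero => simp [genPow]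
  | succ k ih =>
    have h2 : 2 ≤ m k := Nat.AtLeastTwo.prop
    have : 2 * genPow m k ≤ m k * genPow m k := Nat.mul_le_mul_right _ h2
    simp only [genPow]
    omega

theorem finite_mulSupport (m : ℕ → ℕ) [∀ k, (m k).AtLeastTwo] (n : ℕ) (x : Group m) :
    (Function.mulSupport fun k : ℕ => rademacher m k x ^ digit m n k).Finite := by
  refine (Set.finite_lt_nat n).subset fun k hk => ?_
  by_contra h
  have h' : n < genPow m k := lt_of_le_of_lt (not_lt.mp h) (lt_genPow m k)
  exact hk (by simp [digit, Nat.div_eq_of_lt h'])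

/-- The `(i, j)`-th Vilenkin-Fourier coefficient of `f`. -/
def fourierCoeff (m : ℕ → ℕ) [∀ k, (m k).AtLeastTwo] (f : Group m × Group m → ℂ) (i j : ℕ) : ℂ :=
  ∫ p, f p * conj (psi m i p.1) * conj (psi m j p.2) ∂((haar m).prod (haar m))

/-- The rectangular partial sums `S_{M,N}(x, y; f)` of the double Vilenkin-Fourier series. -/
def partialSum (m : ℕ → ℕ) [∀ k, (m k).AtLeastTwo] (f : Group m × Group m → ℂ) (M N : ℕ)
    (x y : Group m) : ℂ :=
  ∑ i ∈ Finset.range M, ∑ j ∈ Finset.range N, fourierCoeff m f i j * psi m i x * psi m j y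

/-- The Marcinkiewicz-Fejér means `σ_n(x, y; f)`, for `n ≥ 1`. -/
def marcinkiewiczFejer (m : ℕ → ℕ) [∀ k, (m k).AtLeastTwo] (f : Group m × Group m → ℂ) (n : ℕ)
    (x y : Group m) : ℂ :=
  (1 / (n : ℂ)) * ∑ j ∈ Finset.range n, partialSum m f j j x y

end Vilenkin

end

/-! Convergence almost everywhere follows from a weak type (1,1) bound for sup_n |σ_n f|
(`Vilenkin.measure_maximal_le`) and convergence on a dense class. If g depends on finitely many
coordinates, its Fourier coefficients vanish outside a finite square, so S_{j,j} g = g for large j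
and the Cesàro means converge everywhere. Such g are dense in L¹ by martingale convergence along the
coordinate filtration.

For n ≤ M_N the function σ_n f factors through the first N coordinates of both variables, where it
is a convolution on a finite group; the maximal bound is proved there with constants independent of
N. Let I_T be the subgroup on which the first T coordinates vanish. A Calderón–Zygmund decomposition
along I_T × I_T (`CosetDecomposition.mul_card_maximal_le`) needs two facts: the kernels are bounded
in L¹, and for each T a kernel is either invariant under I_T × I_T (n ≤ M_T), hence annihilates the
bad part, or lies below a majorant independent of n whose integral off I_T × I_T is bounded
uniformly in T (n ≥ M_T).

The kernel bounds come from splitting sums at the leading digit. Over a complete set of digits a,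
the factors r_k(x+y)^a in front of the Marcinkiewicz kernel of order M_k add up to m_k times the
indicator of x_k + y_k = 0. This preserves its L¹ norm, so passing from M_k to M_{k+1} only adds
terms containing a Dirichlet kernel, and the norm at M_s is O(M_s). Off I_T × I_T with s ≥ T, a
Dirichlet kernel of order M_s confines one variable to I_T, and the growth drops to O((s-T+1) M_T).
Dividing by M_s leaves a series dominated by ∑ (k+1) 2^{-k}. -/

noncomputable section

/-! ### Calderón–Zygmund decomposition on a finite abelian group filtered by subgroups. -/

namespace CosetDecomposition

open scoped Classical in
/-- The average of `f` over the coset `x + Q`. -/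
def cosetAvg {X E : Type*} [AddCommGroup X] [Fintype X] [AddCommGroup E] [Module ℝ E]
    (Q : AddSubgroup X) (f : X → E) (x : X) : E :=
  (Fintype.card Q : ℝ)⁻¹ • ∑ h : Q, f (x + h)

variable {X : Type*} [AddCommGroup X] [Fintype X]

theorem cosetAvg_add {E : Type*} [AddCommGroup E] [Module ℝ E] (Q : AddSubgroup X) (f : X → E)
    (x : X) {h : X} (hh : h ∈ Q) : cosetAvg Q f (x + h) = cosetAvg Q f x := by
  classical
  unfold cosetAvg
  congr 1
  refine Fintype.sum_equiv (Equiv.addLeft (⟨h, hh⟩ : Q)) _ _ fun k => ?_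
  simp [add_assoc]

theorem norm_cosetAvg_le (Q : AddSubgroup X) (f : X → ℂ) (x : X) :
    ‖cosetAvg Q f x‖ ≤ cosetAvg Q (fun z => ‖f z‖) x := by
  unfold cosetAvg
  rw [norm_smul, smul_eq_mul, Real.norm_of_nonneg (by positivity)]
  gcongr
  exact norm_sum_le _ _

theorem cosetAvg_nonneg (Q : AddSubgroup X) {f : X → ℝ} (hf : ∀ x, 0 ≤ f x) (x : X) :
    0 ≤ cosetAvg Q f x := by
  classical
  unfold cosetAvg
  rw [smul_eq_mul]
  have := Finset.sum_nonneg (s := Finset.univ) fun (h : Q) _ => hf (x + h)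
  positivity

theorem cosetAvg_of_eq_bot {E : Type*} [AddCommGroup E] [Module ℝ E] {Q : AddSubgroup X}
    (hQ : Q = ⊥) (f : X → E) (x : X) : cosetAvg Q f x = f x := by
  classical
  have h0 : ∀ h : Q, f (x + h) = f x := fun h => by
    rw [AddSubgroup.mem_bot.mp (hQ.le h.2), add_zero]
  have hc : (Fintype.card Q : ℝ) ≠ 0 := Nat.cast_ne_zero.mpr Fintype.card_ne_zero
  unfold cosetAvg
  simp_rw [h0]
  rw [Finset.sum_const, Finset.card_univ, ← Nat.cast_smul_eq_nsmul ℝ, smul_smul,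
    inv_mul_cancel₀ hc, one_smul]

open scoped Classical in
-- Averaging over cosets is self-adjoint and fixes `u`: each translation by `h ∈ Q` can be moved off
-- `f` without changing `u`.
theorem sum_cosetAvg_mul {𝕜 : Type*} [RCLike 𝕜] (Q : AddSubgroup X) (f u : X → 𝕜)
    (hu : ∀ x, ∀ h ∈ Q, u (x + h) = u x) :
    ∑ x, cosetAvg Q f x * u x = ∑ x, f x * u x := by
  unfold cosetAvg
  have hc : (Fintype.card Q : ℝ) ≠ 0 := Nat.cast_ne_zero.mpr Fintype.card_ne_zero
  simp_rw [smul_mul_assoc, ← Finset.smul_sum, Finset.sum_mul]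
  rw [Finset.sum_comm]
  have : ∀ h : Q, ∑ x, f (x + h) * u x = ∑ x, f x * u x := fun h => by
    rw [← Equiv.sum_comp (Equiv.addRight (h : X)) (fun x => f x * u x)]
    exact Finset.sum_congr rfl fun x _ => by simp [hu x h h.2]
  simp_rw [this]
  rw [Finset.sum_const, Finset.card_univ, ← Nat.cast_smul_eq_nsmul ℝ, smul_smul,
    inv_mul_cancel₀ hc, one_smul]

open scoped Classical in
-- Regularity of the filtration: for nonnegative `f`, passing to a smaller coset raises the average
-- by at most the index, which `R` bounds.
theorem cosetAvg_le_mul {Q Q' : AddSubgroup X} (hQ : Q' ≤ Q) {R : ℝ}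
    (hR : (Fintype.card Q : ℝ) ≤ R * Fintype.card Q') {f : X → ℝ} (hf : ∀ x, 0 ≤ f x) (x : X) :
    cosetAvg Q' f x ≤ R * cosetAvg Q f x := by
  unfold cosetAvg
  simp only [smul_eq_mul]
  have hc : (0 : ℝ) < Fintype.card Q := Nat.cast_pos.mpr Fintype.card_pos
  have hc' : (0 : ℝ) < Fintype.card Q' := Nat.cast_pos.mpr Fintype.card_pos
  have h1 : ∑ h : Q', f (x + h) ≤ ∑ h : Q, f (x + h) := by
    rw [← Finset.sum_image (s := Finset.univ) (g := fun h : Q' => (⟨h, hQ h.2⟩ : Q))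
      (f := fun h : Q => f (x + h)) (fun a _ b _ hab => Subtype.ext (congrArg (fun h : Q => (h : X)) hab))]
    exact Finset.sum_le_sum_of_subset_of_nonneg (Finset.subset_univ _) fun _ _ _ => hf _
  have h0 : 0 ≤ ∑ h : Q, f (x + h) := Finset.sum_nonneg fun _ _ => hf _
  calc _ ≤ (Fintype.card Q' : ℝ)⁻¹ * ∑ h : Q, f (x + h) := by gcongr
    _ ≤ (R * (Fintype.card Q : ℝ)⁻¹) * ∑ h : Q, f (x + h) := by
        gcongr
        rw [inv_le_iff_one_le_mul₀ hc', mul_right_comm, ← div_eq_mul_inv, le_div_iff₀ hc]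
        simpa using hR
    _ = _ := by ring

/-- The points at which the averages of `f` over the cosets of `Q 0, Q 1, …` exceed `t` for the
first time at the index `k`. -/
def stopSet (Q : ℕ → AddSubgroup X) (f : X → ℝ) (t : ℝ) (k : ℕ) : Set X :=
  {x | t < cosetAvg (Q k) f x ∧ ∀ j < k, cosetAvg (Q j) f x ≤ t}

/-- Whether `x` stops at `k` depends only on averages over `Q j ⊇ Q k` with `j ≤ k`, all constant on
the cosets of `Q k`. -/
theorem add_mem_stopSet_iff {Q : ℕ → AddSubgroup X} (hQ : Antitone Q) (f : X → ℝ) (t : ℝ) (k : ℕ)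
    (x : X) {h : X} (hh : h ∈ Q k) : x + h ∈ stopSet Q f t k ↔ x ∈ stopSet Q f t k := by
  have : ∀ j ≤ k, cosetAvg (Q j) f (x + h) = cosetAvg (Q j) f x := fun j hj =>
    cosetAvg_add _ _ _ (hQ hj hh)
  simp only [stopSet, Set.mem_ofPred_eq, this k le_rfl]
  exact and_congr_right fun _ => forall₂_congr fun j hj => by rw [this j hj.le]

theorem eq_of_mem_stopSet {Q : ℕ → AddSubgroup X} {f : X → ℝ} {t : ℝ} {k l : ℕ} {x : X}
    (hk : x ∈ stopSet Q f t k) (hl : x ∈ stopSet Q f t l) : k = l := by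
  rcases lt_trichotomy k l with h | h | h
  · exact absurd hk.1 (not_lt.mpr (hl.2 k h))
  · exact h
  · exact absurd hl.1 (not_lt.mpr (hk.2 l h))

theorem exists_mem_stopSet {Q : ℕ → AddSubgroup X} {f : X → ℝ} {t : ℝ} {k : ℕ} {x : X}
    (hk : t < cosetAvg (Q k) f x) : ∃ j ≤ k, x ∈ stopSet Q f t j := by
  classical
  have hex : ∃ j, t < cosetAvg (Q j) f x := ⟨k, hk⟩
  exact ⟨Nat.find hex, Nat.find_le hk, Nat.find_spec hex,
    fun j hj => not_lt.mp (Nat.find_min hex hj)⟩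

theorem sum_ite_stopSet_le (Q : ℕ → AddSubgroup X) (f g : X → ℝ) (hg : ∀ x, 0 ≤ g x) (t : ℝ)
    (N : ℕ) [∀ k, DecidablePred (· ∈ stopSet Q f t k)] :
    ∑ k ∈ Finset.range N, ∑ x, (if x ∈ stopSet Q f t k then g x else 0) ≤ ∑ x, g x := by
  rw [Finset.sum_comm]
  refine Finset.sum_le_sum fun x _ => ?_
  by_cases h : ∃ k ∈ Finset.range N, x ∈ stopSet Q f t k
  · obtain ⟨k, hk, hx⟩ := h
    rw [Finset.sum_eq_single_of_mem k hk, if_pos hx]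
    intro j _ hj
    exact if_neg fun hxj => hj (eq_of_mem_stopSet hxj hx)
  · rw [Finset.sum_eq_zero]
    · exact hg x
    · intro k hk
      exact if_neg fun hx => h ⟨k, hk, hx⟩

omit [AddCommGroup X] in
open scoped Classical in
theorem mul_card_le_sum {f : X → ℝ} (hf : ∀ x, 0 ≤ f x) (t : ℝ) :
    t * (Finset.univ.filter fun x => t < f x).card ≤ ∑ x, f x := by
  calc t * (Finset.univ.filter fun x => t < f x).card
      = ∑ x ∈ Finset.univ.filter (fun x => t < f x), t := by
        rw [Finset.sum_const, nsmul_eq_mul, mul_comm]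
    _ ≤ ∑ x ∈ Finset.univ.filter (fun x => t < f x), f x :=
        Finset.sum_le_sum fun x hx => (Finset.mem_filter.mp hx).2.le
    _ ≤ ∑ x, f x :=
        Finset.sum_le_sum_of_subset_of_nonneg (Finset.subset_univ _) fun _ _ _ => hf _

open scoped Classical in
-- Doob's maximal inequality: each stopping set is a union of cosets, so `f` and its average have
-- the same sum there; the average exceeds `t`, and the stopping sets are disjoint.
theorem mul_card_stopSet_le {Q : ℕ → AddSubgroup X} (hQ : Antitone Q) {f : X → ℝ}
    (hf : ∀ x, 0 ≤ f x) (t : ℝ) (N : ℕ) :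
    t * (Finset.univ.filter fun x => ∃ k ∈ Finset.range N, x ∈ stopSet Q f t k).card ≤
      ∑ x, f x := by
  have key : ∀ k, ∑ x, cosetAvg (Q k) f x * (if x ∈ stopSet Q f t k then 1 else 0) =
      ∑ x, if x ∈ stopSet Q f t k then f x else 0 := fun k => by
    rw [sum_cosetAvg_mul (𝕜 := ℝ) (Q k) f (fun x => if x ∈ stopSet Q f t k then 1 else 0)
      fun x h hh => by simp only [add_mem_stopSet_iff hQ f t k x hh]]
    exact Finset.sum_congr rfl fun x _ => by simp
  refine le_trans ?_ (sum_ite_stopSet_le Q f f hf t N)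
  simp_rw [← key]
  rw [Finset.sum_comm]
  calc t * (Finset.univ.filter fun x => ∃ k ∈ Finset.range N, x ∈ stopSet Q f t k).card
      = ∑ x ∈ Finset.univ.filter (fun x => ∃ k ∈ Finset.range N, x ∈ stopSet Q f t k), t := by
        rw [Finset.sum_const, nsmul_eq_mul, mul_comm]
    _ ≤ ∑ x ∈ Finset.univ.filter (fun x => ∃ k ∈ Finset.range N, x ∈ stopSet Q f t k),
          ∑ k ∈ Finset.range N, cosetAvg (Q k) f x * (if x ∈ stopSet Q f t k then 1 else 0) := by
        refine Finset.sum_le_sum fun x hx => ?_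
        obtain ⟨k, hk, hxk⟩ := (Finset.mem_filter.mp hx).2
        refine le_trans ?_ (Finset.single_le_sum (f := fun k =>
          cosetAvg (Q k) f x * (if x ∈ stopSet Q f t k then 1 else 0)) (fun j _ => ?_) hk)
        · simpa [hxk] using hxk.1.le
        · have := cosetAvg_nonneg (Q j) hf x
          positivity
    _ ≤ _ := by
        refine Finset.sum_le_sum_of_subset_of_nonneg (Finset.subset_univ _) fun x _ _ =>
          Finset.sum_nonneg fun k _ => ?_
        have := cosetAvg_nonneg (Q k) hf x
        positivity

open scoped Classical in
/-- The part of `f` of mean zero on the cosets of `Q k` contained in the `k`-th stopping set. -/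
def badPart (Q : ℕ → AddSubgroup X) (f : X → ℂ) (t : ℝ) (k : ℕ) (x : X) : ℂ :=
  if x ∈ stopSet Q (fun z => ‖f z‖) t k then f x - cosetAvg (Q k) f x else 0

theorem sum_badPart_mul {Q : ℕ → AddSubgroup X} (hQ : Antitone Q) (f : X → ℂ) (t : ℝ) (k : ℕ)
    (u : X → ℂ) (hu : ∀ x, ∀ h ∈ Q k, u (x + h) = u x) : ∑ x, badPart Q f t k x * u x = 0 := by
  classical
  have := sum_cosetAvg_mul (Q k) f
    (fun x => if x ∈ stopSet Q (fun z => ‖f z‖) t k then u x else 0) fun x h hh => by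
      simp only [add_mem_stopSet_iff hQ _ t k x hh, hu x h hh]
  rw [← sub_eq_zero, ← Finset.sum_sub_distrib] at this
  rw [← neg_eq_zero, ← this, ← Finset.sum_neg_distrib]
  refine Finset.sum_congr rfl fun x _ => ?_
  unfold badPart
  split_ifs <;> ring

open scoped Classical in
theorem sum_norm_badPart_le {Q : ℕ → AddSubgroup X} (hQ : Antitone Q) (f : X → ℂ) (t : ℝ)
    (k : ℕ) : ∑ x, ‖badPart Q f t k x‖ ≤
      2 * ∑ x, if x ∈ stopSet Q (fun z => ‖f z‖) t k then ‖f x‖ else 0 := by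
  have := sum_cosetAvg_mul (𝕜 := ℝ) (Q k) (fun z => ‖f z‖)
    (fun x => if x ∈ stopSet Q (fun z => ‖f z‖) t k then 1 else 0) fun x h hh => by
      simp only [add_mem_stopSet_iff hQ _ t k x hh]
  simp only [mul_ite, mul_one, mul_zero] at this
  calc ∑ x, ‖badPart Q f t k x‖ ≤
      ∑ x, ((if x ∈ stopSet Q (fun z => ‖f z‖) t k then ‖f x‖ else 0) +
        if x ∈ stopSet Q (fun z => ‖f z‖) t k then cosetAvg (Q k) (fun z => ‖f z‖) x else 0) := by
        refine Finset.sum_le_sum fun x _ => ?_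
        unfold badPart
        split_ifs
        · exact (norm_sub_le _ _).trans (by gcongr; exact norm_cosetAvg_le _ _ _)
        · simp
    _ = _ := by rw [Finset.sum_add_distrib, this]; ring

/-- The good part is bounded. On the stopping set of index `k + 1` it is the average over `Q (k +
1)`, at most `R` times the average over `Q k`, which has not yet exceeded `t`; index `0` is excluded
by `h0`. Where nothing stops, `f` itself is small, because averaging over `Q N = ⊥` does nothing. -/
theorem norm_sub_sum_badPart_le {Q : ℕ → AddSubgroup X} (hQ : Antitone Q) {N : ℕ}
    (hN : Q N = ⊥) {R : ℝ} (hR : 1 ≤ R)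
    (hcard : ∀ k, (Nat.card (Q k) : ℝ) ≤ R * Nat.card (Q (k + 1)))
    (f : X → ℂ) {t : ℝ} (ht : 0 < t) (h0 : ∀ x, cosetAvg (Q 0) (fun z => ‖f z‖) x ≤ t) (x : X) :
    ‖f x - ∑ k ∈ Finset.range (N + 1), badPart Q f t k x‖ ≤ R * t := by
  classical
  by_cases h : ∃ k ∈ Finset.range (N + 1), x ∈ stopSet Q (fun z => ‖f z‖) t k
  · obtain ⟨k, hk, hx⟩ := h
    rw [Finset.sum_eq_single_of_mem k hk, badPart, if_pos hx, sub_sub_cancel]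
    · refine (norm_cosetAvg_le _ _ _).trans ?_
      obtain _ | k := k
      · exact absurd hx.1 (not_lt.mpr (h0 x))
      · have hc := hcard k
        rw [Nat.card_eq_fintype_card, Nat.card_eq_fintype_card] at hc
        refine (cosetAvg_le_mul (hQ k.le_succ) hc (fun _ => norm_nonneg _) x).trans ?_
        gcongr
        exact hx.2 k k.lt_succ_self
    · intro j _ hj
      exact if_neg fun hxj => hj (eq_of_mem_stopSet hxj hx)
  · rw [Finset.sum_eq_zero, sub_zero]
    · have h1 : ‖f x‖ ≤ t := by
        by_contra! hlt
        refine h ?_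
        have : cosetAvg (Q N) (fun z => ‖f z‖) x = ‖f x‖ :=
          cosetAvg_of_eq_bot hN _ x
        obtain ⟨j, hj, hxj⟩ := exists_mem_stopSet (Q := Q) (f := fun z => ‖f z‖) (this ▸ hlt)
        exact ⟨j, Finset.mem_range.mpr (by omega), hxj⟩
      nlinarith
    · intro k hk
      exact if_neg fun hx => h ⟨k, hk, hx⟩

open scoped Classical in
/-- The weak type `(1, 1)` inequality for the maximal operator of a family of convolution
operators on a finite group filtered by subgroups. -/
theorem mul_card_maximal_le {ι : Type*} {Q : ℕ → AddSubgroup X} (hQ : Antitone Q)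
    (hQ0 : Q 0 = ⊤) {N : ℕ} (hN : Q N = ⊥) {R : ℝ} (hR : 1 ≤ R)
    (hcard : ∀ k, (Nat.card (Q k) : ℝ) ≤ R * Nat.card (Q (k + 1)))
    {C : ℝ} (hC : 0 ≤ C) {K : ι → X → ℂ} (hK : ∀ n, ∑ x, ‖K n x‖ ≤ C) {L : ℕ → X → ℝ}
    (hL0 : ∀ k x, 0 ≤ L k x)
    (hL : ∀ k ≤ N, ∑ x, (if x ∈ Q k then 0 else L k x) ≤ C)
    (hKL : ∀ n, ∀ k ≤ N, (∀ x, ∀ h ∈ Q k, K n (x + h) = K n x) ∨ ∀ x, ‖K n x‖ ≤ L k x)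
    (f : X → ℂ) {t : ℝ} (ht : 0 < t) :
    t * (Finset.univ.filter fun x => ∃ n, (C * R + 1) * t < ‖∑ q, f q * K n (x - q)‖).card ≤
      (1 + 2 * C) * ∑ x, ‖f x‖ := by
  set S := ∑ x, ‖f x‖ with hS
  have hS0 : 0 ≤ S := Finset.sum_nonneg fun _ _ => norm_nonneg _
  have havg0 : ∀ x, cosetAvg (Q 0) (fun z => ‖f z‖) x = (Fintype.card X : ℝ)⁻¹ * S := fun x => by
    have : Fintype.card (Q 0) = Fintype.card X := by
      rw [← Nat.card_eq_fintype_card, ← Nat.card_eq_fintype_card, hQ0, AddSubgroup.card_top]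
    rw [cosetAvg, this, smul_eq_mul, hS]
    congr 1
    refine Fintype.sum_bijective (fun h : Q 0 => x + h) ⟨fun a b hab => ?_, fun z => ?_⟩ _ _
      fun _ => rfl
    · exact Subtype.ext (add_left_cancel hab)
    · exact ⟨⟨z - x, by simp [hQ0]⟩, by simp⟩
  have hcX : (0 : ℝ) < Fintype.card X := Nat.cast_pos.mpr Fintype.card_pos
  -- If the global average exceeds `t`, then `t * |X| < S` and counting all points is enough.
  by_cases h0 : ∀ x, cosetAvg (Q 0) (fun z => ‖f z‖) x ≤ t
  swap
  · push Not at h0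
    obtain ⟨x, hx⟩ := h0
    rw [havg0, inv_mul_eq_div, lt_div_iff₀ hcX] at hx
    have : ((Finset.univ.filter fun x =>
        ∃ n, (C * R + 1) * t < ‖∑ q, f q * K n (x - q)‖).card : ℝ) ≤ Fintype.card X := by
      exact_mod_cast Finset.card_le_univ _
    calc _ ≤ t * Fintype.card X := by gcongr
      _ ≤ S := hx.le
      _ ≤ _ := by nlinarith
  set b : ℕ → X → ℂ := badPart Q f t with hb
  -- `H` dominates the bad contribution off the stopping sets simultaneously for all `n`; being free
  -- of `n`, it can be handled by Chebyshev's inequality.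
  set H : X → ℝ := fun x => ∑ k ∈ Finset.range (N + 1), ∑ q,
    ‖b k q‖ * (if x - q ∈ Q k then 0 else L k (x - q)) with hH
  have hite0 : ∀ k x, 0 ≤ if x ∈ Q k then 0 else L k x := fun k x => by
    split_ifs
    exacts [le_rfl, hL0 k x]
  have hH0 : ∀ x, 0 ≤ H x := fun x => Finset.sum_nonneg fun k _ => Finset.sum_nonneg fun q _ =>
    mul_nonneg (norm_nonneg _) (hite0 _ _)
  have hHsum : ∑ x, H x ≤ 2 * C * S := by
    calc ∑ x, H x = ∑ k ∈ Finset.range (N + 1), ∑ q, ‖b k q‖ *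
          ∑ x, (if x - q ∈ Q k then 0 else L k (x - q)) := by
          simp only [hH]
          rw [Finset.sum_comm]
          refine Finset.sum_congr rfl fun k _ => ?_
          rw [Finset.sum_comm]
          simp_rw [Finset.mul_sum]
      _ = ∑ k ∈ Finset.range (N + 1), ∑ q, ‖b k q‖ * ∑ x, (if x ∈ Q k then 0 else L k x) := by
          refine Finset.sum_congr rfl fun k _ => Finset.sum_congr rfl fun q _ => ?_
          congr 1
          exact (Equiv.subRight q).sum_comp (fun x => if x ∈ Q k then 0 else L k x)
      _ ≤ ∑ k ∈ Finset.range (N + 1), ∑ q, ‖b k q‖ * C := by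
          gcongr with k hk q
          exact hL k (by simpa [Nat.lt_succ_iff] using hk)
      _ ≤ ∑ k ∈ Finset.range (N + 1),
          (2 * ∑ x, if x ∈ stopSet Q (fun z => ‖f z‖) t k then ‖f x‖ else 0) * C := by
          simp_rw [← Finset.sum_mul]
          gcongr with k hk
          exact sum_norm_badPart_le hQ f t k
      _ = 2 * C * ∑ k ∈ Finset.range (N + 1),
          ∑ x, if x ∈ stopSet Q (fun z => ‖f z‖) t k then ‖f x‖ else 0 := by
          rw [← Finset.sum_mul, ← Finset.mul_sum]; ring
      _ ≤ _ := by
          gcongr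
          exact sum_ite_stopSet_le Q _ _ (fun _ => norm_nonneg _) t _
  -- The threshold splits as `C * R * t` for the good part and `t` for `H`.
  have hsub : (Finset.univ.filter fun x => ∃ n, (C * R + 1) * t < ‖∑ q, f q * K n (x - q)‖) ⊆
      (Finset.univ.filter fun x => ∃ k ∈ Finset.range (N + 1),
        x ∈ stopSet Q (fun z => ‖f z‖) t k) ∪ Finset.univ.filter fun x => t < H x := by
    intro x hx
    obtain ⟨n, hn⟩ := (Finset.mem_filter.mp hx).2
    by_contra hx'
    simp only [Finset.mem_union, Finset.mem_filter, Finset.mem_univ, true_and, not_or, not_exists,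
      not_and, not_lt] at hx'
    obtain ⟨hx1, hx2⟩ := hx'
    have hgood : ‖∑ q, (f q - ∑ k ∈ Finset.range (N + 1), b k q) * K n (x - q)‖ ≤ C * R * t := by
      calc _ ≤ ∑ q, ‖(f q - ∑ k ∈ Finset.range (N + 1), b k q) * K n (x - q)‖ := norm_sum_le _ _
        _ ≤ ∑ q, R * t * ‖K n (x - q)‖ := by
            gcongr with q
            rw [norm_mul]
            gcongr
            exact norm_sub_sum_badPart_le hQ hN hR hcard f ht h0 q
        _ = R * t * ∑ q, ‖K n q‖ := by
            rw [← Finset.mul_sum, ← Equiv.sum_comp (Equiv.subLeft x) (fun q => ‖K n q‖)]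
            rfl
        _ ≤ R * t * C := by gcongr; exact hK n
        _ = _ := by ring
    have hbad : ∀ k ∈ Finset.range (N + 1), ‖∑ q, b k q * K n (x - q)‖ ≤
        ∑ q, ‖b k q‖ * (if x - q ∈ Q k then 0 else L k (x - q)) := by
      intro k hk
      rcases hKL n k (by simpa [Nat.lt_succ_iff] using hk) with h | h
      · rw [hb, sum_badPart_mul hQ f t k (fun q => K n (x - q)), norm_zero]
        · exact Finset.sum_nonneg fun q _ => mul_nonneg (norm_nonneg _) (hite0 _ _)
        · intro q z hz
          rw [← h (x - (q + z)) z hz]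
          congr 1
          abel
      · refine (norm_sum_le _ _).trans (Finset.sum_le_sum fun q _ => ?_)
        split_ifs with hxq
        -- The coset of `q` contains `x`, so `q` stopping at `k` would make `x` stop too. Hence the
        -- majorant is only needed off `Q k`.
        · have : q ∉ stopSet Q (fun z => ‖f z‖) t k := fun hq => by
            rw [← add_mem_stopSet_iff hQ _ t k q hxq, add_sub_cancel] at hq
            exact hx1 k hk hq
          simp [hb, badPart, this]
        · rw [norm_mul]
          gcongr
          exact h _
    have hsplit : ∑ q, f q * K n (x - q) =
        ∑ q, (f q - ∑ k ∈ Finset.range (N + 1), b k q) * K n (x - q) +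
          ∑ k ∈ Finset.range (N + 1), ∑ q, b k q * K n (x - q) := by
      rw [Finset.sum_comm, ← Finset.sum_add_distrib]
      refine Finset.sum_congr rfl fun q _ => ?_
      rw [← Finset.sum_mul]
      ring
    have : ‖∑ q, f q * K n (x - q)‖ ≤ C * R * t + t := by
      rw [hsplit]
      refine (norm_add_le _ _).trans (add_le_add hgood ?_)
      exact ((norm_sum_le _ _).trans (Finset.sum_le_sum hbad)).trans hx2
    linarith
  have hc := (Finset.card_le_card hsub).trans (Finset.card_union_le _ _)
  have h1 := mul_card_stopSet_le hQ (fun x => norm_nonneg (f x)) t (N + 1)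
  have h2 := mul_card_le_sum hH0 t
  have hc' := mul_le_mul_of_nonneg_left (Nat.cast_le (α := ℝ).mpr hc) ht.le
  rw [Nat.cast_add, mul_add] at hc'
  refine hc'.trans ?_
  rw [add_mul, one_mul]
  refine add_le_add ?_ (h2.trans hHsum)
  refine (le_of_eq ?_).trans h1
  congr!

end CosetDecomposition

end

/-! ### Dirichlet, Fejér and Marcinkiewicz kernels: block formulas and pointwise bounds. -/

noncomputable section

namespace Vilenkin

variable (m : ℕ → ℕ)

theorem genPow_succ (k : ℕ) : genPow m (k + 1) = m k * genPow m k := rfl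

theorem genPow_dvd {j k : ℕ} (h : j ≤ k) : genPow m j ∣ genPow m k := by
  induction k, h using Nat.le_induction with
  | base => exact dvd_rfl
  | succ k _ ih => exact ih.mul_left _

theorem digit_add_of_lt {j k : ℕ} (h : j < k) (a l : ℕ) :
    digit m (a * genPow m k + l) j = digit m l j := by
  obtain ⟨c, hc⟩ := genPow_dvd m (Nat.succ_le_of_lt h)
  rcases Nat.eq_zero_or_pos (genPow m j) with h0 | h0
  · simp [digit, h0]
  · have : a * genPow m k + l = l + genPow m j * (m j * (c * a)) := by
      rw [hc, Nat.succ_eq_add_one, genPow_succ]; ring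
    rw [digit, this, Nat.add_mul_div_left _ _ h0, Nat.add_mul_mod_self_left, digit]

theorem digit_of_lt {n k : ℕ} (h : n < genPow m k) : digit m n k = 0 := by
  simp [digit, Nat.div_eq_of_lt h]

theorem digit_add_self {k a l : ℕ} (ha : a < m k) (hl : l < genPow m k) :
    digit m (a * genPow m k + l) k = a := by
  rw [digit, Nat.add_comm, Nat.add_mul_div_right _ _ (by omega), Nat.div_eq_of_lt hl, zero_add,
    Nat.mod_eq_of_lt ha]

theorem add_lt_genPow_succ {k a l : ℕ} (ha : a < m k) (hl : l < genPow m k) :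
    a * genPow m k + l < genPow m (k + 1) := by
  rw [genPow_succ]
  nlinarith

variable [∀ k, (m k).AtLeastTwo]

theorem genPow_pos (k : ℕ) : 0 < genPow m k := (Nat.zero_le k).trans_lt (lt_genPow m k)

theorem two_mul_genPow_le (k : ℕ) : 2 * genPow m k ≤ genPow m (k + 1) := by
  rw [genPow_succ]
  exact Nat.mul_le_mul_right _ Nat.AtLeastTwo.prop

theorem genPow_mono : Monotone (genPow m) :=
  monotone_nat_of_le_succ fun k => by have := two_mul_genPow_le m k; omega

theorem sum_genPow_le (k : ℕ) : ∑ j ∈ Finset.range k, genPow m j ≤ genPow m k := by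
  induction k with
  | zero => simp
  | succ k ih =>
    rw [Finset.sum_range_succ]
    have := two_mul_genPow_le m k
    omega

theorem exists_block {k n : ℕ} (h : n < genPow m (k + 1)) :
    ∃ a < m k, ∃ l < genPow m k, n = a * genPow m k + l := by
  refine ⟨n / genPow m k, ?_, n % genPow m k, Nat.mod_lt _ (genPow_pos m k),
    (Nat.div_add_mod' _ _).symm⟩
  rw [Nat.div_lt_iff_lt_mul (genPow_pos m k)]
  exact h

variable {m}

theorem rademacher_eq (k : ℕ) (x : Group m) : rademacher m k x = ZMod.stdAddChar (x k) := by
  rw [ZMod.stdAddChar_apply, ZMod.toCircle_apply]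
  rfl

theorem rademacher_add (k : ℕ) (x y : Group m) :
    rademacher m k (x + y) = rademacher m k x * rademacher m k y := by
  simp only [rademacher_eq, Pi.add_apply, AddChar.map_add_eq_mul]

theorem norm_rademacher (k : ℕ) (x : Group m) : ‖rademacher m k x‖ = 1 := by
  rw [rademacher_eq, ZMod.stdAddChar_apply, Circle.norm_coe]

theorem rademacher_neg (k : ℕ) (x : Group m) :
    rademacher m k (-x) = conj (rademacher m k x) := by
  rw [rademacher_eq, rademacher_eq, Pi.neg_apply, AddChar.map_neg_eq_conj]

theorem sum_rademacher_pow (k : ℕ) (x : Group m) :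
    ∑ a ∈ Finset.range (m k), rademacher m k x ^ a = if x k = 0 then (m k : ℂ) else 0 := by
  rw [rademacher_eq]
  split_ifs with h
  · simp [h]
  · have h1 : (ZMod.stdAddChar (x k) : ℂ) ≠ 1 := fun h1 =>
      h (ZMod.injective_stdAddChar (by rw [h1, AddChar.map_zero_eq_one]))
    rw [geom_sum_eq h1, ← AddChar.map_nsmul_eq_pow]
    simp

theorem psi_eq_prod {n K : ℕ} (h : n < genPow m K) (x : Group m) :
    psi m n x = ∏ k ∈ Finset.range K, rademacher m k x ^ digit m n k := by
  refine finprod_eq_prod_of_mulSupport_subset _ fun k hk => ?_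
  by_contra hk'
  simp only [Finset.coe_range, Set.mem_Iio, not_lt] at hk'
  exact hk (by simp [digit_of_lt m (h.trans_le (genPow_mono m hk'))])

theorem psi_block {k a l : ℕ} (ha : a < m k) (hl : l < genPow m k) (x : Group m) :
    psi m (a * genPow m k + l) x = rademacher m k x ^ a * psi m l x := by
  rw [psi_eq_prod (add_lt_genPow_succ m ha hl), Finset.prod_range_succ, digit_add_self m ha hl,
    psi_eq_prod hl, mul_comm]
  congr 1
  exact Finset.prod_congr rfl fun j hj => by rw [digit_add_of_lt m (Finset.mem_range.mp hj)]

theorem psi_zero (x : Group m) : psi m 0 x = 1 := by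
  rw [psi_eq_prod (K := 0) (by simp [genPow])]
  simp

theorem psi_add (n : ℕ) (x y : Group m) : psi m n (x + y) = psi m n x * psi m n y := by
  simp only [psi_eq_prod (lt_genPow m n), rademacher_add, mul_pow, Finset.prod_mul_distrib]

theorem psi_neg (n : ℕ) (x : Group m) : psi m n (-x) = conj (psi m n x) := by
  simp only [psi_eq_prod (lt_genPow m n), rademacher_neg, map_prod, map_pow]

theorem psi_sub (n : ℕ) (x y : Group m) : psi m n (x - y) = psi m n x * conj (psi m n y) := by
  rw [sub_eq_add_neg, psi_add, psi_neg]

theorem norm_psi (n : ℕ) (x : Group m) : ‖psi m n x‖ = 1 := by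
  simp [psi_eq_prod (lt_genPow m n), norm_prod, norm_rademacher]

theorem psi_congr {n K : ℕ} (h : n < genPow m K) {x y : Group m} (hxy : ∀ k < K, x k = y k) :
    psi m n x = psi m n y := by
  rw [psi_eq_prod h, psi_eq_prod h]
  refine Finset.prod_congr rfl fun k hk => ?_
  rw [rademacher_eq, rademacher_eq, hxy k (Finset.mem_range.mp hk)]

theorem sum_range_block {E : Type*} [AddCommMonoid E] (g : ℕ → E) (M a L : ℕ) :
    ∑ j ∈ Finset.range (a * M + L), g j =
      ∑ b ∈ Finset.range a, ∑ l ∈ Finset.range M, g (b * M + l) +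
        ∑ l ∈ Finset.range L, g (a * M + l) := by
  rw [Finset.sum_range_add]
  congr 1
  induction a with
  | zero => simp
  | succ a ih => rw [Finset.sum_range_succ, ← ih, add_mul, one_mul, Finset.sum_range_add]

variable (m) in
/-- The Dirichlet kernels. -/
def dirichlet (n : ℕ) (x : Group m) : ℂ := ∑ i ∈ Finset.range n, psi m i x

variable (m) in
/-- The unnormalized Fejér kernels. -/
def fejer (n : ℕ) (x : Group m) : ℂ := ∑ j ∈ Finset.range n, dirichlet m j x

variable (m) in
/-- The unnormalized Marcinkiewicz kernels. -/
def marcinkiewicz (n : ℕ) (x y : Group m) : ℂ :=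
  ∑ j ∈ Finset.range n, dirichlet m j x * dirichlet m j y

variable (m) in
/-- The partial sums of the geometric series of a generalized Rademacher function. -/
def radSum (k a : ℕ) (x : Group m) : ℂ := ∑ b ∈ Finset.range a, rademacher m k x ^ b

theorem norm_radSum_le (k a : ℕ) (x : Group m) : ‖radSum m k a x‖ ≤ a := by
  refine (norm_sum_le _ _).trans ?_
  simp [norm_rademacher]

/-- On the block with leading digit `b` the characters are `r_k ^ b` times those of index below
`M_k`; full blocks give a geometric sum, the last one is partial. -/
theorem dirichlet_block {k a l : ℕ} (ha : a < m k) (hl : l ≤ genPow m k) (x : Group m) :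
    dirichlet m (a * genPow m k + l) x =
      radSum m k a x * dirichlet m (genPow m k) x + rademacher m k x ^ a * dirichlet m l x := by
  rw [dirichlet, sum_range_block, radSum, Finset.sum_mul]
  congr 1
  · refine Finset.sum_congr rfl fun b hb => ?_
    rw [dirichlet, Finset.mul_sum]
    exact Finset.sum_congr rfl fun i hi =>
      psi_block ((Finset.mem_range.mp hb).trans ha) (Finset.mem_range.mp hi) x
  · rw [dirichlet, Finset.mul_sum]
    exact Finset.sum_congr rfl fun i hi => psi_block ha ((Finset.mem_range.mp hi).trans_le hl) x

theorem dirichlet_genPow (k : ℕ) (x : Group m) :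
    dirichlet m (genPow m k) x = if ∀ j < k, x j = 0 then (genPow m k : ℂ) else 0 := by
  induction k with
  | zero => simp [genPow, dirichlet, psi_zero]
  | succ k ih =>
    have h2 : 2 ≤ m k := Nat.AtLeastTwo.prop
    -- The block formula needs a leading digit below `m k` but allows `l = M_k`, so the last full
    -- block is treated as the remainder.
    have h1 : genPow m (k + 1) = (m k - 1) * genPow m k + genPow m k := by
      rw [genPow_succ, ← Nat.succ_mul]; congr; omega
    have h3 : radSum m k (m k - 1) x + rademacher m k x ^ (m k - 1) =
        if x k = 0 then (m k : ℂ) else 0 := by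
      rw [← sum_rademacher_pow, radSum, ← Finset.sum_range_succ]
      congr; omega
    have h4 : (∀ j < k + 1, x j = 0) ↔ x k = 0 ∧ ∀ j < k, x j = 0 :=
      ⟨fun h => ⟨h k k.lt_succ_self, fun j hj => h j (by omega)⟩, fun h j hj =>
        (Nat.lt_succ_iff_lt_or_eq.mp hj).elim (h.2 j) (fun hj => hj ▸ h.1)⟩
    rw [h1, dirichlet_block (by omega) le_rfl, ← add_mul, h3, ih, ← h1, genPow_succ]
    simp only [h4]
    by_cases ha : x k = 0 <;> by_cases hb : ∀ j < k, x j = 0 <;> simp [ha, hb]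

theorem sum_dirichlet_block {k a L : ℕ} (ha : a < m k) (hL : L ≤ genPow m k) (x : Group m) :
    ∑ l ∈ Finset.range L, dirichlet m (a * genPow m k + l) x =
      L * (radSum m k a x * dirichlet m (genPow m k) x) +
        rademacher m k x ^ a * fejer m L x := by
  rw [fejer, Finset.mul_sum]
  simp_rw [← nsmul_eq_mul L]
  rw [← Finset.card_range L, ← Finset.sum_const, Finset.card_range, ← Finset.sum_add_distrib]
  exact Finset.sum_congr rfl fun l hl =>
    dirichlet_block ha ((Finset.mem_range.mp hl).le.trans hL) x

/-- The product of two block formulas. The remainders multiply to a power of `r_k (x + y)`, which is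
why the Marcinkiewicz recursion sees only `x k + y k`. -/
theorem sum_dirichlet_mul_block {k a L : ℕ} (ha : a < m k) (hL : L ≤ genPow m k)
    (x y : Group m) :
    ∑ l ∈ Finset.range L,
        dirichlet m (a * genPow m k + l) x * dirichlet m (a * genPow m k + l) y =
      L * ((radSum m k a x * dirichlet m (genPow m k) x) *
          (radSum m k a y * dirichlet m (genPow m k) y)) +
        (radSum m k a x * dirichlet m (genPow m k) x) *
          (rademacher m k y ^ a * fejer m L y) +
        (radSum m k a y * dirichlet m (genPow m k) y) *
          (rademacher m k x ^ a * fejer m L x) +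
        rademacher m k (x + y) ^ a * marcinkiewicz m L x y := by
  rw [fejer, fejer, marcinkiewicz]
  simp_rw [Finset.mul_sum, ← nsmul_eq_mul L]
  rw [← Finset.card_range L, ← Finset.sum_const, Finset.card_range, ← Finset.sum_add_distrib,
    ← Finset.sum_add_distrib, ← Finset.sum_add_distrib]
  refine Finset.sum_congr rfl fun l hl => ?_
  have hl' := (Finset.mem_range.mp hl).le.trans hL
  rw [dirichlet_block ha hl', dirichlet_block ha hl', rademacher_add]
  ring

section Bounds

variable {B : ℕ} (hB : ∀ k, m k ≤ B)
include hB

theorem norm_radSum_mul_le {k a : ℕ} (ha : a < m k) (x : Group m) (z : ℂ) :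
    ‖radSum m k a x * z‖ ≤ B * ‖z‖ := by
  rw [norm_mul]
  gcongr
  exact (norm_radSum_le k a x).trans (by exact_mod_cast ha.le.trans (hB k))

theorem norm_sum_dirichlet_block_le {k a L : ℕ} (ha : a < m k) (hL : L ≤ genPow m k)
    (x : Group m) :
    ‖∑ l ∈ Finset.range L, dirichlet m (a * genPow m k + l) x‖ ≤
      B * genPow m k * ‖dirichlet m (genPow m k) x‖ + ‖fejer m L x‖ := by
  rw [sum_dirichlet_block ha hL]
  refine (norm_add_le _ _).trans (add_le_add ?_ ?_)
  · rw [norm_mul, Complex.norm_natCast, mul_comm (B : ℝ), mul_assoc]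
    exact mul_le_mul (by exact_mod_cast hL) (norm_radSum_mul_le hB ha x _) (norm_nonneg _)
      (by positivity)
  · simp [norm_rademacher]

theorem norm_cross_terms_le {k a L : ℕ} (ha : a < m k) (hL : L ≤ genPow m k)
    (x y : Group m) :
    ‖(L : ℂ) * ((radSum m k a x * dirichlet m (genPow m k) x) *
          (radSum m k a y * dirichlet m (genPow m k) y)) +
        (radSum m k a x * dirichlet m (genPow m k) x) *
          (rademacher m k y ^ a * fejer m L y) +
        (radSum m k a y * dirichlet m (genPow m k) y) *
          (rademacher m k x ^ a * fejer m L x)‖ ≤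
      B ^ 2 * genPow m k * (‖dirichlet m (genPow m k) x‖ * ‖dirichlet m (genPow m k) y‖) +
        B * (‖dirichlet m (genPow m k) x‖ * ‖fejer m L y‖) +
        B * (‖dirichlet m (genPow m k) y‖ * ‖fejer m L x‖) := by
  have hx := norm_radSum_mul_le hB ha x (dirichlet m (genPow m k) x)
  have hy := norm_radSum_mul_le hB ha y (dirichlet m (genPow m k) y)
  refine (norm_add₃_le).trans (add_le_add (add_le_add ?_ ?_) ?_)
  · rw [norm_mul, norm_mul _ (radSum m k a y * _), Complex.norm_natCast]
    calc _ ≤ (genPow m k : ℝ) * ((B * ‖dirichlet m (genPow m k) x‖) *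
          (B * ‖dirichlet m (genPow m k) y‖)) := by
          gcongr
      _ = _ := by ring
  · rw [norm_mul, norm_mul _ (fejer m L y), norm_pow, norm_rademacher, one_pow, one_mul,
      ← mul_assoc]
    gcongr
  · rw [norm_mul, norm_mul _ (fejer m L x), norm_pow, norm_rademacher, one_pow, one_mul,
      ← mul_assoc]
    gcongr

theorem norm_sum_dirichlet_mul_block_le {k a L : ℕ} (ha : a < m k) (hL : L ≤ genPow m k)
    (x y : Group m) :
    ‖∑ l ∈ Finset.range L,
        dirichlet m (a * genPow m k + l) x * dirichlet m (a * genPow m k + l) y‖ ≤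
      B ^ 2 * genPow m k * (‖dirichlet m (genPow m k) x‖ * ‖dirichlet m (genPow m k) y‖) +
        B * (‖dirichlet m (genPow m k) x‖ * ‖fejer m L y‖) +
        B * (‖dirichlet m (genPow m k) y‖ * ‖fejer m L x‖) + ‖marcinkiewicz m L x y‖ := by
  rw [sum_dirichlet_mul_block ha hL]
  refine (norm_add_le _ _).trans (add_le_add (norm_cross_terms_le hB ha hL x y) ?_)
  simp [norm_rademacher]

/-- Orthogonality over all digits `a < m k` replaces the powers in front of the lower Fejér kernel
by `m k` times an indicator of probability `1 / m k`; a bound of all the powers by `1` would lose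
this and let the `L¹` norm grow too fast. -/
theorem norm_fejer_genPow_succ_le (k : ℕ) (x : Group m) :
    ‖fejer m (genPow m (k + 1)) x‖ ≤
      B ^ 2 * genPow m k * ‖dirichlet m (genPow m k) x‖ +
        if x k = 0 then m k * ‖fejer m (genPow m k) x‖ else 0 := by
  have h : fejer m (genPow m (k + 1)) x =
      ∑ a ∈ Finset.range (m k), (genPow m k : ℂ) *
        (radSum m k a x * dirichlet m (genPow m k) x) +
      (if x k = 0 then (m k : ℂ) else 0) * fejer m (genPow m k) x := by
    rw [fejer, genPow_succ, ← Nat.add_zero (m k * _), sum_range_block, Finset.sum_range_zero,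
      add_zero, ← sum_rademacher_pow, Finset.sum_mul, ← Finset.sum_add_distrib]
    exact Finset.sum_congr rfl fun a ha =>
      sum_dirichlet_block (Finset.mem_range.mp ha) le_rfl x
  rw [h]
  refine (norm_add_le _ _).trans (add_le_add ?_ ?_)
  · refine (norm_sum_le _ _).trans ?_
    calc _ ≤ ∑ a ∈ Finset.range (m k), genPow m k * (B * ‖dirichlet m (genPow m k) x‖) := by
          refine Finset.sum_le_sum fun a ha => ?_
          rw [norm_mul, Complex.norm_natCast]
          gcongr
          exact norm_radSum_mul_le hB (Finset.mem_range.mp ha) x _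
      _ = m k * (genPow m k * (B * ‖dirichlet m (genPow m k) x‖)) := by simp
      _ ≤ B * (genPow m k * (B * ‖dirichlet m (genPow m k) x‖)) := by
          gcongr
          exact hB k
      _ = _ := by ring
  · split_ifs <;> simp

theorem norm_marcinkiewicz_genPow_succ_le (k : ℕ) (x y : Group m) :
    ‖marcinkiewicz m (genPow m (k + 1)) x y‖ ≤
      B ^ 3 * genPow m k * (‖dirichlet m (genPow m k) x‖ * ‖dirichlet m (genPow m k) y‖) +
        B ^ 2 * (‖dirichlet m (genPow m k) x‖ * ‖fejer m (genPow m k) y‖) +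
        B ^ 2 * (‖dirichlet m (genPow m k) y‖ * ‖fejer m (genPow m k) x‖) +
        if x k + y k = 0 then m k * ‖marcinkiewicz m (genPow m k) x y‖ else 0 := by
  have h : marcinkiewicz m (genPow m (k + 1)) x y =
      ∑ a ∈ Finset.range (m k), ((genPow m k : ℂ) *
          ((radSum m k a x * dirichlet m (genPow m k) x) *
          (radSum m k a y * dirichlet m (genPow m k) y)) +
        (radSum m k a x * dirichlet m (genPow m k) x) *
          (rademacher m k y ^ a * fejer m (genPow m k) y) +
        (radSum m k a y * dirichlet m (genPow m k) y) *
          (rademacher m k x ^ a * fejer m (genPow m k) x)) +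
      (if x k + y k = 0 then (m k : ℂ) else 0) * marcinkiewicz m (genPow m k) x y := by
    rw [marcinkiewicz, genPow_succ, ← Nat.add_zero (m k * _), sum_range_block,
      Finset.sum_range_zero, add_zero, ← Pi.add_apply, ← sum_rademacher_pow, Finset.sum_mul,
      ← Finset.sum_add_distrib]
    exact Finset.sum_congr rfl fun a ha =>
      sum_dirichlet_mul_block (Finset.mem_range.mp ha) le_rfl x y
  rw [h]
  refine (norm_add_le _ _).trans (add_le_add ?_ ?_)
  · refine (norm_sum_le _ _).trans ((Finset.sum_le_sum fun a ha =>
      norm_cross_terms_le hB (Finset.mem_range.mp ha) le_rfl x y).trans ?_)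
    rw [Finset.sum_const, Finset.card_range, nsmul_eq_mul]
    calc _ ≤ (B : ℝ) * _ := by
          gcongr
          exact hB k
      _ = _ := by ring
  · split_ifs <;> simp

end Bounds

variable (m) in
/-- A majorant of the kernels `fejer m n`, `n < genPow m S`. -/
def fejerMajorant (B S : ℕ) (x : Group m) : ℝ :=
  ∑ s ∈ Finset.range S,
    B * (B * genPow m s * ‖dirichlet m (genPow m s) x‖ + ‖fejer m (genPow m s) x‖)

omit [∀ k, (m k).AtLeastTwo] in
theorem fejerMajorant_nonneg (B S : ℕ) (x : Group m) : 0 ≤ fejerMajorant m B S x :=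
  Finset.sum_nonneg fun _ _ => by positivity

omit [∀ k, (m k).AtLeastTwo] in
theorem fejerMajorant_succ (B S : ℕ) (x : Group m) :
    fejerMajorant m B (S + 1) x = fejerMajorant m B S x +
      B * (B * genPow m S * ‖dirichlet m (genPow m S) x‖ + ‖fejer m (genPow m S) x‖) :=
  Finset.sum_range_succ _ _

variable (m) in
/-- The terms of a majorant of the kernels `marcinkiewicz m n`. -/
def marcinkiewiczTerm (B s : ℕ) (x y : Group m) : ℝ :=
  B * (B ^ 2 * genPow m s * (‖dirichlet m (genPow m s) x‖ * ‖dirichlet m (genPow m s) y‖) +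
    B * (‖dirichlet m (genPow m s) x‖ * fejerMajorant m B (s + 1) y) +
    B * (‖dirichlet m (genPow m s) y‖ * fejerMajorant m B (s + 1) x) +
    ‖marcinkiewicz m (genPow m s) x y‖)

omit [∀ k, (m k).AtLeastTwo] in
theorem marcinkiewiczTerm_nonneg (B s : ℕ) (x y : Group m) :
    0 ≤ marcinkiewiczTerm m B s x y := by
  have := fejerMajorant_nonneg B (s + 1) x
  have := fejerMajorant_nonneg B (s + 1) y
  unfold marcinkiewiczTerm
  positivity

section Bounds

variable {B : ℕ} (hB : ∀ k, m k ≤ B)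
include hB

theorem one_le_bound : (1 : ℝ) ≤ B := by
  have h2 : 2 ≤ m 0 := Nat.AtLeastTwo.prop
  have := hB 0
  exact_mod_cast (by omega : 1 ≤ B)

theorem norm_fejer_le {S n : ℕ} (hn : n < genPow m S) (x : Group m) :
    ‖fejer m n x‖ ≤ fejerMajorant m B S x := by
  induction S generalizing n with
  | zero =>
    have : n = 0 := by simpa [genPow] using hn
    simp [this, fejer, fejerMajorant]
  | succ S ih =>
    obtain ⟨a, ha, L, hL, rfl⟩ := exists_block m hn
    set d := ‖dirichlet m (genPow m S) x‖
    have h1 : ‖∑ b ∈ Finset.range a, ∑ l ∈ Finset.range (genPow m S),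
        dirichlet m (b * genPow m S + l) x‖ ≤
        a * (B * genPow m S * d + ‖fejer m (genPow m S) x‖) := by
      refine (norm_sum_le _ _).trans ((Finset.sum_le_sum fun b hb =>
        norm_sum_dirichlet_block_le hB ((Finset.mem_range.mp hb).trans ha) le_rfl x).trans ?_)
      simp [d, mul_add]
    have h2 := norm_sum_dirichlet_block_le hB ha hL.le x
    have h3 : (a : ℝ) + 1 ≤ B := by exact_mod_cast Nat.lt_of_lt_of_le ha (hB S)
    rw [fejer, sum_range_block, fejerMajorant_succ]
    calc _ ≤ a * (B * genPow m S * d + ‖fejer m (genPow m S) x‖) +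
          (B * genPow m S * d + ‖fejer m L x‖) := (norm_add_le _ _).trans (add_le_add h1 h2)
      -- One superfluous kernel norm is added so that the partial block counts like a full one,
      -- giving `a + 1 ≤ B` equal terms.
      _ ≤ a * (B * genPow m S * d + ‖fejer m (genPow m S) x‖) +
          (B * genPow m S * d + ‖fejer m (genPow m S) x‖ + ‖fejer m L x‖) := by
          have := norm_nonneg (fejer m (genPow m S) x)
          gcongr
          linarith
      _ = ‖fejer m L x‖ + (a + 1) * (B * genPow m S * d + ‖fejer m (genPow m S) x‖) := by ring
      _ ≤ _ := by
          gcongr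
          exact ih hL

/-- Full blocks need `n = M_S`, which is not below `M_S`; this is the source of the index `s + 1` in
`marcinkiewiczTerm`. -/
theorem norm_fejer_le_succ {S n : ℕ} (hn : n ≤ genPow m S) (x : Group m) :
    ‖fejer m n x‖ ≤ fejerMajorant m B (S + 1) x :=
  norm_fejer_le hB (hn.trans_lt (by
    have := two_mul_genPow_le m S
    have := genPow_pos m S
    omega)) x

theorem norm_marcinkiewicz_le {S n : ℕ} (hn : n < genPow m S) (x y : Group m) :
    ‖marcinkiewicz m n x y‖ ≤ ∑ s ∈ Finset.range S, marcinkiewiczTerm m B s x y := by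
  induction S generalizing n with
  | zero =>
    have : n = 0 := by simpa [genPow] using hn
    simp [this, marcinkiewicz]
  | succ S ih =>
    obtain ⟨a, ha, L, hL, rfl⟩ := exists_block m hn
    set T := B ^ 2 * genPow m S *
      (‖dirichlet m (genPow m S) x‖ * ‖dirichlet m (genPow m S) y‖) +
      B * (‖dirichlet m (genPow m S) x‖ * fejerMajorant m B (S + 1) y) +
      B * (‖dirichlet m (genPow m S) y‖ * fejerMajorant m B (S + 1) x) with hT
    have key : ∀ {b L}, b < m S → L ≤ genPow m S → ‖∑ l ∈ Finset.range L,
        dirichlet m (b * genPow m S + l) x * dirichlet m (b * genPow m S + l) y‖ ≤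
        T + ‖marcinkiewicz m L x y‖ := fun {b L} hb hL => by
      refine (norm_sum_dirichlet_mul_block_le hB hb hL x y).trans ?_
      rw [hT]
      gcongr
      · exact norm_fejer_le_succ hB hL y
      · exact norm_fejer_le_succ hB hL x
    have h1 : ‖∑ b ∈ Finset.range a, ∑ l ∈ Finset.range (genPow m S),
        dirichlet m (b * genPow m S + l) x * dirichlet m (b * genPow m S + l) y‖ ≤
        a * (T + ‖marcinkiewicz m (genPow m S) x y‖) := by
      refine (norm_sum_le _ _).trans ((Finset.sum_le_sum fun b hb =>
        key ((Finset.mem_range.mp hb).trans ha) le_rfl).trans ?_)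
      simp [mul_add]
    have h2 := key ha hL.le
    have h3 : (a : ℝ) + 1 ≤ B := by exact_mod_cast Nat.lt_of_lt_of_le ha (hB S)
    have h4 := norm_nonneg (marcinkiewicz m (genPow m S) x y)
    have hT0 : 0 ≤ T := by
      have := fejerMajorant_nonneg B (S + 1) x
      have := fejerMajorant_nonneg B (S + 1) y
      positivity
    rw [marcinkiewicz, sum_range_block, Finset.sum_range_succ]
    calc _ ≤ a * (T + ‖marcinkiewicz m (genPow m S) x y‖) + (T + ‖marcinkiewicz m L x y‖) :=
          (norm_add_le _ _).trans (add_le_add h1 h2)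
      _ ≤ a * (T + ‖marcinkiewicz m (genPow m S) x y‖) +
          (T + ‖marcinkiewicz m (genPow m S) x y‖ + ‖marcinkiewicz m L x y‖) := by
          gcongr
          linarith
      _ = ‖marcinkiewicz m L x y‖ + (a + 1) * (T + ‖marcinkiewicz m (genPow m S) x y‖) := by
          ring
      _ ≤ _ := by
          refine add_le_add (ih hL) ?_
          rw [marcinkiewiczTerm]
          gcongr

end Bounds

end Vilenkin

end

/-! ### `L¹` bounds for the kernels, globally and off the subgroups of the filtration. -/

noncomputable section

namespace Vilenkin

/-- The product of the first `N` factors of the Vilenkin group. -/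
abbrev FinGroup (m : ℕ → ℕ) (N : ℕ) : Type := (k : Fin N) → ZMod (m k)

variable {m : ℕ → ℕ}

variable (m) in
/-- The extension of an element of the product of the first `N` factors by zeros. -/
def extend (N : ℕ) : FinGroup m N →+ Group m where
  toFun u k := if h : k < N then u ⟨k, h⟩ else 0
  map_zero' := by ext k; simp
  map_add' u v := by
    ext k
    by_cases h : k < N <;> simp [h]

theorem extend_of_lt {N k : ℕ} (h : k < N) (u : FinGroup m N) : extend m N u k = u ⟨k, h⟩ := by
  simp [extend, h]

/-- A function on the Vilenkin group that depends on the first `s` coordinates only. -/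
def DependsBelow {α : Type*} (s : ℕ) (φ : Group m → α) : Prop :=
  ∀ x y, (∀ k < s, x k = y k) → φ x = φ y

variable [∀ k, (m k).AtLeastTwo]

theorem card_finGroup (N : ℕ) : Fintype.card (FinGroup m N) = genPow m N := by
  rw [Fintype.card_pi]
  simp only [ZMod.card]
  induction N with
  | zero => simp [genPow]
  | succ N ih =>
    have : ∏ x : Fin N, m x = genPow m N := ih
    rw [Fin.prod_univ_castSucc, genPow_succ, mul_comm]
    simp [this]

theorem dependsBelow_dirichlet {n s : ℕ} (h : n ≤ genPow m s) :
    DependsBelow s (dirichlet m n) := fun _ _ hxy =>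
  Finset.sum_congr rfl fun _ hi => psi_congr ((Finset.mem_range.mp hi).trans_le h) hxy

theorem dependsBelow_fejer {n s : ℕ} (h : n ≤ genPow m s) :
    DependsBelow s (fejer m n) := fun _ _ hxy =>
  Finset.sum_congr rfl fun _ hi =>
    dependsBelow_dirichlet ((Finset.mem_range.mp hi).le.trans h) _ _ hxy

theorem marcinkiewicz_congr {n s : ℕ} (h : n ≤ genPow m s) {x x' y y' : Group m}
    (hx : ∀ k < s, x k = x' k) (hy : ∀ k < s, y k = y' k) :
    marcinkiewicz m n x y = marcinkiewicz m n x' y' :=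
  Finset.sum_congr rfl fun _ hi => by
    rw [dependsBelow_dirichlet ((Finset.mem_range.mp hi).le.trans h) _ _ hx,
      dependsBelow_dirichlet ((Finset.mem_range.mp hi).le.trans h) _ _ hy]

/-- The mean value of a function over the product of the first `N` factors. -/
def mean (N : ℕ) (φ : Group m → ℝ) : ℝ := (genPow m N : ℝ)⁻¹ * ∑ u, φ (extend m N u)

theorem genPow_cast_pos (N : ℕ) : (0 : ℝ) < genPow m N := Nat.cast_pos.mpr (genPow_pos m N)

theorem mean_mono {N : ℕ} {φ χ : Group m → ℝ} (h : ∀ x, φ x ≤ χ x) : mean N φ ≤ mean N χ := by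
  unfold mean
  gcongr
  exact h _

theorem mean_add (N : ℕ) (φ χ : Group m → ℝ) :
    mean N (fun x => φ x + χ x) = mean N φ + mean N χ := by
  simp [mean, Finset.sum_add_distrib, mul_add]

theorem mean_const_mul (N : ℕ) (c : ℝ) (φ : Group m → ℝ) :
    mean N (fun x => c * φ x) = c * mean N φ := by
  simp only [mean, ← Finset.mul_sum]
  ring

theorem mean_mul_const (N : ℕ) (c : ℝ) (φ : Group m → ℝ) :
    mean N (fun x => φ x * c) = mean N φ * c := by
  simp_rw [mul_comm _ c, mean_const_mul]

theorem mean_sum {ι : Type*} (N : ℕ) (s : Finset ι) (φ : ι → Group m → ℝ) :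
    mean N (fun x => ∑ i ∈ s, φ i x) = ∑ i ∈ s, mean N (φ i) := by
  simp only [mean, ← Finset.mul_sum]
  rw [Finset.sum_comm]

theorem mean_const (N : ℕ) (c : ℝ) : mean (m := m) N (fun _ => c) = c := by
  rw [mean, Finset.sum_const, Finset.card_univ, card_finGroup, nsmul_eq_mul,
    inv_mul_cancel_left₀ (genPow_cast_pos N).ne']

/-- A function of the first `s` coordinates is independent of the coordinate `s`. -/
theorem mean_ite {N s : ℕ} (hs : s < N) {φ : Group m → ℝ} (hφ : DependsBelow s φ)
    (c : ZMod (m s)) : mean N (fun x => if x s = c then m s * φ x else 0) = mean N φ := by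
  unfold mean
  congr 1
  -- Translation by `c - c'` in the coordinate `s` does not change `φ`, so all `m s` values of that
  -- coordinate contribute equally.
  have hsum : ∀ c', ∑ u : FinGroup m N, (if extend m N u s = c' then φ (extend m N u) else 0) =
      ∑ u : FinGroup m N, if extend m N u s = c then φ (extend m N u) else 0 := fun c' => by
    rw [← Equiv.sum_comp (Equiv.addRight (Pi.single ⟨s, hs⟩ (c - c') : FinGroup m N)) fun u =>
      if extend m N u s = c then φ (extend m N u) else 0]
    refine Finset.sum_congr rfl fun u _ => ?_
    have h1 : extend m N (u + Pi.single ⟨s, hs⟩ (c - c')) s = extend m N u s + (c - c') := by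
      rw [map_add, Pi.add_apply, extend_of_lt hs (Pi.single _ _), Pi.single_eq_same]
    have h2 : φ (extend m N (u + Pi.single ⟨s, hs⟩ (c - c'))) = φ (extend m N u) := by
      refine hφ _ _ fun k hk => ?_
      rw [map_add, Pi.add_apply, extend_of_lt (hk.trans hs) (Pi.single _ _),
        Pi.single_eq_of_ne (by simp [Fin.ext_iff, hk.ne]), add_zero]
    simp only [Equiv.coe_addRight, h1, h2]
    have h3 : extend m N u s = c' ↔ extend m N u s + (c - c') = c := by
      rw [← sub_eq_zero, ← sub_eq_zero (b := c)]
      ring_nf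
    simp only [h3]
  calc ∑ u : FinGroup m N, (if extend m N u s = c then m s * φ (extend m N u) else 0)
      = m s * ∑ u : FinGroup m N, if extend m N u s = c then φ (extend m N u) else 0 := by
        rw [Finset.mul_sum]
        simp_rw [mul_ite, mul_zero]
    _ = ∑ c' : ZMod (m s), ∑ u : FinGroup m N,
          if extend m N u s = c' then φ (extend m N u) else 0 := by
        simp_rw [hsum, Finset.sum_const, Finset.card_univ, ZMod.card, nsmul_eq_mul]
    _ = _ := by
        rw [Finset.sum_comm]
        simp

theorem mean_norm_dirichlet {N s : ℕ} (hs : s ≤ N) :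
    mean N (fun x => ‖dirichlet m (genPow m s) x‖) = 1 := by
  induction s with
  | zero => simp [dirichlet, genPow, psi_zero, mean_const]
  | succ s ih =>
    rw [← ih (by omega), ← mean_ite (m := m) (N := N) (s := s) (by omega)
      (φ := fun x => ‖dirichlet m (genPow m s) x‖)
      (fun x y h => congrArg norm (dependsBelow_dirichlet le_rfl x y h)) 0]
    congr 1
    ext x
    have h4 : (∀ j < s + 1, x j = 0) ↔ x s = 0 ∧ ∀ j < s, x j = 0 :=
      ⟨fun h => ⟨h s s.lt_succ_self, fun j hj => h j (by omega)⟩, fun h j hj =>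
        (Nat.lt_succ_iff_lt_or_eq.mp hj).elim (h.2 j) (fun hj => hj ▸ h.1)⟩
    simp only [dirichlet_genPow, h4]
    rw [genPow_succ]
    by_cases ha : x s = 0
    · by_cases hb : ∀ j < s, x j = 0
      · rw [if_pos ⟨ha, hb⟩, if_pos ha, if_pos hb]
        simp
      · rw [if_neg (fun h => hb h.2), if_pos ha, if_neg hb]
        simp
    · rw [if_neg (fun h => ha h.1), if_neg ha, norm_zero]

open scoped Classical in
/-- The indicator of the complement of the subgroup where the first `T` coordinates vanish. -/
def outside (T : ℕ) (x : Group m) : ℝ := if ∀ k < T, x k = 0 then 0 else 1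

open scoped Classical in
/-- The indicator of the complement of the square of the subgroup where the first `T` coordinates
vanish. -/
def outsideSq (T : ℕ) (x y : Group m) : ℝ :=
  if (∀ k < T, x k = 0) ∧ ∀ k < T, y k = 0 then 0 else 1

omit [∀ k, (m k).AtLeastTwo] in
theorem outside_nonneg (T : ℕ) (x : Group m) : 0 ≤ outside T x := by
  unfold outside; split_ifs <;> simp

omit [∀ k, (m k).AtLeastTwo] in
theorem outside_le_one (T : ℕ) (x : Group m) : outside T x ≤ 1 := by
  unfold outside; split_ifs <;> simp

omit [∀ k, (m k).AtLeastTwo] in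
theorem outsideSq_nonneg (T : ℕ) (x y : Group m) : 0 ≤ outsideSq T x y := by
  unfold outsideSq; split_ifs <;> simp

omit [∀ k, (m k).AtLeastTwo] in
theorem outsideSq_le_one (T : ℕ) (x y : Group m) : outsideSq T x y ≤ 1 := by
  unfold outsideSq; split_ifs <;> simp

omit [∀ k, (m k).AtLeastTwo] in
theorem outsideSq_comm (T : ℕ) (x y : Group m) : outsideSq T x y = outsideSq T y x := by
  simp only [outsideSq, and_comm]

omit [∀ k, (m k).AtLeastTwo] in
theorem dependsBelow_outside {s T : ℕ} (h : T ≤ s) : DependsBelow (m := m) s (outside T) := by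
  intro x y hxy
  have : (∀ k < T, x k = 0) ↔ ∀ k < T, y k = 0 :=
    forall₂_congr fun k hk => by rw [hxy k (hk.trans_le h)]
  simp only [outside, this]

omit [∀ k, (m k).AtLeastTwo] in
theorem dependsBelow_outsideSq {s T : ℕ} (h : T ≤ s) (x : Group m) :
    DependsBelow s (outsideSq T x) := by
  intro y y' hy
  have : (∀ k < T, y k = 0) ↔ ∀ k < T, y' k = 0 :=
    forall₂_congr fun k hk => by rw [hy k (hk.trans_le h)]
  simp only [outsideSq, this]

theorem norm_dirichlet_mul_outside {s T : ℕ} (h : T ≤ s) (x : Group m) :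
    ‖dirichlet m (genPow m s) x‖ * outside T x = 0 := by
  rw [dirichlet_genPow, outside]
  by_cases h1 : ∀ j < s, x j = 0
  · have h2 : ∀ k < T, x k = 0 := fun k hk => h1 k (hk.trans_le h)
    rw [if_pos h2, mul_zero]
  · simp [h1]

/-- The Dirichlet kernel confines `x` to the subgroup, so a pair outside the square must have `y`
outside. -/
theorem norm_dirichlet_mul_outsideSq {s T : ℕ} (h : T ≤ s) (x y : Group m) :
    ‖dirichlet m (genPow m s) x‖ * outsideSq T x y =
      ‖dirichlet m (genPow m s) x‖ * outside T y := by
  rw [dirichlet_genPow, outside, outsideSq]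
  by_cases h1 : ∀ j < s, x j = 0
  · have h2 : ∀ k < T, x k = 0 := fun k hk => h1 k (hk.trans_le h)
    simp only [and_iff_right h2]
  · simp [h1]

section Bounds

variable {B : ℕ} (hB : ∀ k, m k ≤ B) {N : ℕ}

omit [∀ k, (m k).AtLeastTwo] in
theorem fejer_genPow_zero (x : Group m) : fejer m (genPow m 0) x = 0 := by
  simp [fejer, dirichlet, genPow]

omit [∀ k, (m k).AtLeastTwo] in
theorem marcinkiewicz_genPow_zero (x y : Group m) : marcinkiewicz m (genPow m 0) x y = 0 := by
  simp [marcinkiewicz, dirichlet, genPow]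

include hB

/-- The factor `m s` is cancelled by `mean_ite`. The weight `χ` is `1` for the global norm and
`outside T` for the norm off the subgroup. -/
theorem mean_norm_fejer_succ_le {s : ℕ} (hs : s < N) {χ : Group m → ℝ} (hχ0 : ∀ x, 0 ≤ χ x)
    (hχ : DependsBelow s χ) :
    mean N (fun x => ‖fejer m (genPow m (s + 1)) x‖ * χ x) ≤
      B ^ 2 * genPow m s * mean N (fun x => ‖dirichlet m (genPow m s) x‖ * χ x) +
        mean N (fun x => ‖fejer m (genPow m s) x‖ * χ x) := by
  have hφ : DependsBelow s (fun x => ‖fejer m (genPow m s) x‖ * χ x) := fun x y h => by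
    simp only [dependsBelow_fejer le_rfl x y h, hχ x y h]
  rw [← mean_ite hs hφ 0, ← mean_const_mul, ← mean_add]
  refine mean_mono fun x => ?_
  refine (mul_le_mul_of_nonneg_right (norm_fejer_genPow_succ_le hB s x) (hχ0 x)).trans_eq ?_
  split_ifs <;> ring

theorem mean_norm_fejer_le {s : ℕ} (hs : s ≤ N) :
    mean N (fun x => ‖fejer m (genPow m s) x‖) ≤ B ^ 2 * genPow m s := by
  have key : ∀ s ≤ N, mean N (fun x => ‖fejer m (genPow m s) x‖) ≤
      B ^ 2 * ∑ t ∈ Finset.range s, (genPow m t : ℝ) := by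
    intro s hs
    induction s with
    | zero => simp [fejer_genPow_zero, mean_const]
    | succ s ih =>
      have h := mean_norm_fejer_succ_le hB (N := N) (s := s) (by omega) (χ := fun _ => 1)
        (fun _ => zero_le_one) (fun _ _ _ => rfl)
      simp only [mul_one, mean_norm_dirichlet (m := m) (N := N) (s := s) (by omega)] at h
      rw [Finset.sum_range_succ, mul_add]
      linarith [ih (by omega)]
  refine (key s hs).trans ?_
  gcongr
  exact_mod_cast sum_genPow_le m s

/-- From `s = T` on, the Dirichlet term of the recursion vanishes off the subgroup, so the mean
stops growing. -/
theorem mean_norm_fejer_mul_outside_le {s : ℕ} (hs : s ≤ N) (T : ℕ) :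
    mean N (fun x => ‖fejer m (genPow m s) x‖ * outside T x) ≤ B ^ 2 * genPow m T := by
  induction s with
  | zero =>
    simp only [fejer_genPow_zero, norm_zero, zero_mul, mean_const]
    positivity
  | succ s ih =>
    rcases Nat.lt_or_ge s T with h | h
    · refine (mean_mono fun x => mul_le_of_le_one_right (norm_nonneg _)
        (outside_le_one T x)).trans ((mean_norm_fejer_le hB hs).trans ?_)
      gcongr
      exact_mod_cast genPow_mono m h
    · refine (mean_norm_fejer_succ_le hB (by omega) (outside_nonneg T)
        (dependsBelow_outside h)).trans ?_
      simp only [norm_dirichlet_mul_outside h, mean_const, mul_zero, zero_add]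
      exact ih (by omega)

theorem mean_fejerMajorant_le {S : ℕ} (hS : S ≤ N + 1) :
    mean N (fejerMajorant m B S) ≤ 2 * B ^ 3 * genPow m S := by
  have h1 := one_le_bound hB
  unfold fejerMajorant
  rw [mean_sum]
  calc _ ≤ ∑ s ∈ Finset.range S, 2 * (B : ℝ) ^ 3 * genPow m s := by
        refine Finset.sum_le_sum fun s hs => ?_
        have hsN : s ≤ N := by have := Finset.mem_range.mp hs; omega
        rw [mean_const_mul, mean_add, mean_const_mul, mean_norm_dirichlet hsN]
        have h2 := mean_norm_fejer_le hB hsN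
        have h3 : (B : ℝ) ≤ B ^ 2 := by nlinarith
        calc _ ≤ (B : ℝ) * (B ^ 2 * genPow m s * 1 + B ^ 2 * genPow m s) := by gcongr
          _ = _ := by ring
    _ ≤ _ := by
        rw [← Finset.mul_sum]
        gcongr
        exact_mod_cast sum_genPow_le m S

theorem mean_fejerMajorant_mul_outside_le {S T : ℕ} (hTS : T ≤ S) (hS : S ≤ N + 1) :
    mean N (fun x => fejerMajorant m B S x * outside T x) ≤
      ((S : ℝ) - T + 2) * B ^ 3 * genPow m T := by
  induction S, hTS using Nat.le_induction with
  | base =>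
    refine (mean_mono fun x => mul_le_of_le_one_right (fejerMajorant_nonneg B T x)
      (outside_le_one T x)).trans ((mean_fejerMajorant_le hB hS).trans_eq ?_)
    ring
  | succ S hTS ih =>
    have h : ∀ x : Group m, fejerMajorant m B (S + 1) x * outside T x =
        fejerMajorant m B S x * outside T x +
          B * (‖fejer m (genPow m S) x‖ * outside T x) := fun x => by
      rw [fejerMajorant_succ]
      linear_combination (B : ℝ) * B * genPow m S * norm_dirichlet_mul_outside hTS x
    simp_rw [h]
    rw [mean_add, mean_const_mul]
    have h1 := mean_norm_fejer_mul_outside_le hB (N := N) (s := S) (by omega) T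
    have h2 := ih (by omega)
    push_cast
    calc _ ≤ ((S : ℝ) - T + 2) * B ^ 3 * genPow m T + B * (B ^ 2 * genPow m T) := by gcongr
      _ = _ := by ring

theorem mean_mean_norm_marcinkiewicz_succ_le {s : ℕ} (hs : s < N) {χ : Group m → Group m → ℝ}
    (hχ0 : ∀ x y, 0 ≤ χ x y) (hχ : ∀ x, DependsBelow s (χ x)) :
    mean N (fun x => mean N fun y => ‖marcinkiewicz m (genPow m (s + 1)) x y‖ * χ x y) ≤
      B ^ 3 * genPow m s * mean N (fun x => mean N fun y =>
        ‖dirichlet m (genPow m s) x‖ * ‖dirichlet m (genPow m s) y‖ * χ x y) +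
      B ^ 2 * mean N (fun x => mean N fun y =>
        ‖dirichlet m (genPow m s) x‖ * ‖fejer m (genPow m s) y‖ * χ x y) +
      B ^ 2 * mean N (fun x => mean N fun y =>
        ‖dirichlet m (genPow m s) y‖ * ‖fejer m (genPow m s) x‖ * χ x y) +
      mean N (fun x => mean N fun y => ‖marcinkiewicz m (genPow m s) x y‖ * χ x y) := by
  have hφ : ∀ x, DependsBelow s (fun y => ‖marcinkiewicz m (genPow m s) x y‖ * χ x y) :=
    fun x y z h => by
      simp only [marcinkiewicz_congr le_rfl (fun _ _ => rfl : ∀ k < s, x k = x k) h, hχ x y z h]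
  -- For fixed `x`, the condition `x s + y s = 0` prescribes one value of `y s`, so independence is
  -- used in `y` alone.
  simp_rw [fun x : Group m => (mean_ite hs (hφ x) (-x s)).symm, ← mean_const_mul, ← mean_add]
  refine mean_mono fun x => mean_mono fun y => ?_
  refine (mul_le_mul_of_nonneg_right (norm_marcinkiewicz_genPow_succ_le hB s x y)
    (hχ0 x y)).trans_eq ?_
  have : y s = -x s ↔ x s + y s = 0 := by rw [eq_neg_iff_add_eq_zero, add_comm]
  simp only [this]
  split_ifs <;> ring

theorem mean_mean_norm_marcinkiewicz_le {s : ℕ} (hs : s ≤ N) :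
    mean N (fun x => mean N fun y => ‖marcinkiewicz m (genPow m s) x y‖) ≤
      3 * B ^ 4 * genPow m s := by
  have h1 := one_le_bound hB
  have key : ∀ s ≤ N, mean N (fun x => mean N fun y => ‖marcinkiewicz m (genPow m s) x y‖) ≤
      3 * B ^ 4 * ∑ t ∈ Finset.range s, (genPow m t : ℝ) := by
    intro s hs
    induction s with
    | zero => simp [marcinkiewicz_genPow_zero, mean_const]
    | succ s ih =>
      have h := mean_mean_norm_marcinkiewicz_succ_le hB (N := N) (s := s) (by omega)
        (χ := fun _ _ => 1) (fun _ _ => zero_le_one) (fun _ _ _ _ => rfl)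
      simp only [mul_one, mean_const_mul, mean_mul_const,
        mean_norm_dirichlet (m := m) (N := N) (s := s) (by omega), one_mul] at h
      have h2 := mean_norm_fejer_le hB (N := N) (s := s) (by omega)
      have h3 : (B : ℝ) ^ 3 ≤ B ^ 4 := pow_le_pow_right₀ h1 (by norm_num)
      rw [Finset.sum_range_succ, mul_add]
      calc _ ≤ _ := h
        _ ≤ (B : ℝ) ^ 4 * genPow m s + B ^ 2 * (B ^ 2 * genPow m s) +
            B ^ 2 * (B ^ 2 * genPow m s) + 3 * B ^ 4 * ∑ t ∈ Finset.range s, (genPow m t : ℝ) := by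
            gcongr
            exact ih (by omega)
        _ = _ := by ring
  refine (key s hs).trans ?_
  gcongr
  exact_mod_cast sum_genPow_le m s

omit hB in
theorem mean_mean_dirichlet_mul_outsideSq {s T : ℕ} (hTs : T ≤ s) (hs : s ≤ N)
    (φ : Group m → ℝ) :
    mean N (fun x => mean N fun y => ‖dirichlet m (genPow m s) x‖ * φ y * outsideSq T x y) =
      mean N fun y => φ y * outside T y := by
  have : ∀ x y, ‖dirichlet m (genPow m s) x‖ * φ y * outsideSq T x y =
      ‖dirichlet m (genPow m s) x‖ * (φ y * outside T y) := fun x y => by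
    linear_combination φ y * norm_dirichlet_mul_outsideSq hTs x y
  simp_rw [this, mean_const_mul, mean_mul_const, mean_norm_dirichlet hs, one_mul]

omit hB in
theorem mean_mean_dirichlet_mul_outsideSq' {s T : ℕ} (hTs : T ≤ s) (hs : s ≤ N)
    (φ : Group m → ℝ) :
    mean N (fun x => mean N fun y => ‖dirichlet m (genPow m s) y‖ * φ x * outsideSq T x y) =
      mean N fun x => φ x * outside T x := by
  have : ∀ x y, ‖dirichlet m (genPow m s) y‖ * φ x * outsideSq T x y =
      ‖dirichlet m (genPow m s) y‖ * (φ x * outside T x) := fun x y => by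
    rw [outsideSq_comm]
    linear_combination φ x * norm_dirichlet_mul_outsideSq hTs y x
  simp_rw [this, mean_mul_const, mean_norm_dirichlet hs, one_mul]

/-- For `s ≥ T` the product of Dirichlet kernels vanishes off the square and each mixed term costs
at most `B ^ 4 * M_T`, so growth in `s` is linear instead of geometric. -/
theorem mean_mean_norm_marcinkiewicz_mul_outsideSq_le {s T : ℕ} (hTs : T ≤ s) (hs : s ≤ N) :
    mean N (fun x => mean N fun y => ‖marcinkiewicz m (genPow m s) x y‖ * outsideSq T x y) ≤
      3 * B ^ 4 * ((s : ℝ) - T + 1) * genPow m T := by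
  induction s, hTs using Nat.le_induction with
  | base =>
    refine (mean_mono fun x => mean_mono fun y => mul_le_of_le_one_right (norm_nonneg _)
      (outsideSq_le_one T x y)).trans ((mean_mean_norm_marcinkiewicz_le hB hs).trans_eq ?_)
    ring
  | succ s hTs ih =>
    have h := mean_mean_norm_marcinkiewicz_succ_le hB (N := N) (s := s) (by omega)
      (outsideSq_nonneg T) (dependsBelow_outsideSq hTs)
    have hsN : s ≤ N := by omega
    rw [mean_mean_dirichlet_mul_outsideSq hTs hsN, mean_mean_dirichlet_mul_outsideSq hTs hsN,
      mean_mean_dirichlet_mul_outsideSq' hTs hsN] at h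
    simp only [norm_dirichlet_mul_outside hTs, mean_const, mul_zero, zero_add] at h
    have h1 := mean_norm_fejer_mul_outside_le hB hsN T
    have h2 := ih hsN
    push_cast
    calc _ ≤ _ := h
      _ ≤ (B : ℝ) ^ 2 * (B ^ 2 * genPow m T) + B ^ 2 * (B ^ 2 * genPow m T) +
          3 * B ^ 4 * ((s : ℝ) - T + 1) * genPow m T := by gcongr
      -- A spare `B ^ 4 * M_T` rounds the increment up to the slope `3 * B ^ 4` dictated by the base
      -- case.
      _ ≤ (B : ℝ) ^ 2 * (B ^ 2 * genPow m T) + B ^ 2 * (B ^ 2 * genPow m T) +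
          3 * B ^ 4 * ((s : ℝ) - T + 1) * genPow m T + B ^ 4 * genPow m T := by
          have : (0 : ℝ) ≤ B ^ 4 * genPow m T := by positivity
          linarith
      _ = _ := by ring

theorem mean_mean_marcinkiewiczTerm_le {s : ℕ} (hs : s ≤ N) :
    mean N (fun x => mean N fun y => marcinkiewiczTerm m B s x y) ≤ 9 * B ^ 6 * genPow m s := by
  have h1 := one_le_bound hB
  have h2 := mean_fejerMajorant_le hB (N := N) (S := s + 1) (by omega)
  have h3 := mean_mean_norm_marcinkiewicz_le hB hs
  have h4 : (genPow m (s + 1) : ℝ) ≤ B * genPow m s := by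
    rw [genPow_succ]
    exact_mod_cast Nat.mul_le_mul_right _ (hB s)
  have h5 : (B : ℝ) ^ 2 ≤ B ^ 5 := pow_le_pow_right₀ h1 (by norm_num)
  have h6 : (B : ℝ) ^ 4 ≤ B ^ 5 := pow_le_pow_right₀ h1 (by norm_num)
  have h7 : mean N (fejerMajorant m B (s + 1)) ≤ 2 * B ^ 3 * (B * genPow m s) :=
    h2.trans (by gcongr)
  unfold marcinkiewiczTerm
  simp only [mean_const_mul, mean_add, mean_mul_const, mean_norm_dirichlet hs, one_mul, mul_one]
  calc _ ≤ (B : ℝ) * (B ^ 5 * genPow m s + B * (2 * B ^ 3 * (B * genPow m s)) +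
        B * (2 * B ^ 3 * (B * genPow m s)) + 3 * B ^ 5 * genPow m s) := by
        refine mul_le_mul_of_nonneg_left ?_ (by positivity)
        refine add_le_add (add_le_add (add_le_add ?_ ?_) ?_) (h3.trans ?_)
        all_goals gcongr
    _ = 8 * B ^ 6 * genPow m s := by ring
    -- Rounded up from 8 to share the constant of the estimate off the square.
    _ ≤ _ := by gcongr; norm_num

theorem mean_mean_marcinkiewiczTerm_mul_outsideSq_le {s T : ℕ} (hTs : T ≤ s) (hs : s ≤ N) :
    mean N (fun x => mean N fun y => marcinkiewiczTerm m B s x y * outsideSq T x y) ≤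
      9 * B ^ 6 * (((s : ℝ) - T + 1) * genPow m T) := by
  have h1 := one_le_bound hB
  have h2 := mean_fejerMajorant_mul_outside_le hB (N := N) (S := s + 1) (T := T) (by omega)
    (by omega)
  have h3 := mean_mean_norm_marcinkiewicz_mul_outsideSq_le hB hTs hs
  have hT : (T : ℝ) ≤ s := by exact_mod_cast hTs
  set r : ℝ := (s : ℝ) - T + 1 with hr
  have hr0 : 1 ≤ r := by linarith
  -- With `S = s + 1` the factor is `r + 2`, and `r ≥ 1`.
  have h4 : mean N (fun x => fejerMajorant m B (s + 1) x * outside T x) ≤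
      (3 * r) * B ^ 3 * genPow m T := by
    refine h2.trans ?_
    gcongr
    push_cast
    linarith
  have h6 : (B : ℝ) ^ 5 ≤ B ^ 6 := pow_le_pow_right₀ h1 (by norm_num)
  have h5 : ∀ x y, marcinkiewiczTerm m B s x y * outsideSq T x y =
      B ^ 3 * genPow m s * (‖dirichlet m (genPow m s) x‖ * ‖dirichlet m (genPow m s) y‖ *
        outsideSq T x y) +
      B ^ 2 * (‖dirichlet m (genPow m s) x‖ * fejerMajorant m B (s + 1) y * outsideSq T x y) +
      B ^ 2 * (‖dirichlet m (genPow m s) y‖ * fejerMajorant m B (s + 1) x * outsideSq T x y) +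
      B * (‖marcinkiewicz m (genPow m s) x y‖ * outsideSq T x y) := fun x y => by
    unfold marcinkiewiczTerm
    ring
  simp_rw [h5, mean_add, mean_const_mul]
  rw [mean_mean_dirichlet_mul_outsideSq hTs hs, mean_mean_dirichlet_mul_outsideSq hTs hs,
    mean_mean_dirichlet_mul_outsideSq' hTs hs]
  simp only [norm_dirichlet_mul_outside hTs, mean_const, mul_zero, zero_add]
  calc _ ≤ (B : ℝ) ^ 2 * ((3 * r) * B ^ 3 * genPow m T) +
        B ^ 2 * ((3 * r) * B ^ 3 * genPow m T) + B * (3 * B ^ 4 * r * genPow m T) := by gcongr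
    _ = 9 * B ^ 5 * (r * genPow m T) := by ring
    _ ≤ _ := by gcongr

omit hB in
theorem exists_genPow_le_lt {n : ℕ} (hn : 1 ≤ n) :
    ∃ A, genPow m A ≤ n ∧ n < genPow m (A + 1) := by
  classical
  have hex : ∃ k, n < genPow m k := ⟨n, lt_genPow m n⟩
  have h0 : Nat.find hex ≠ 0 := fun h => by
    have := Nat.find_spec hex
    rw [h] at this
    simp [genPow] at this
    omega
  obtain ⟨A, hA⟩ := Nat.exists_eq_succ_of_ne_zero h0
  exact ⟨A, not_lt.mp (Nat.find_min hex (by omega)), by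
    have := Nat.find_spec hex
    rwa [hA] at this⟩

theorem mean_mean_norm_marcinkiewicz_le_mul {n : ℕ} (hn : 1 ≤ n) (hnN : n < genPow m N) :
    mean N (fun x => mean N fun y => ‖marcinkiewicz m n x y‖) ≤ 18 * B ^ 6 * n := by
  obtain ⟨A, hA, hA'⟩ := exists_genPow_le_lt (m := m) hn
  have hAN : A < N := by
    by_contra! h
    have := genPow_mono m h
    omega
  calc _ ≤ mean N (fun x => mean N fun y =>
        ∑ s ∈ Finset.range (A + 1), marcinkiewiczTerm m B s x y) :=
        mean_mono fun x => mean_mono fun y => norm_marcinkiewicz_le hB hA' x y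
    _ = ∑ s ∈ Finset.range (A + 1),
        mean N (fun x => mean N fun y => marcinkiewiczTerm m B s x y) := by
        simp_rw [mean_sum]
    _ ≤ ∑ s ∈ Finset.range (A + 1), 9 * (B : ℝ) ^ 6 * genPow m s :=
        Finset.sum_le_sum fun s hs => mean_mean_marcinkiewiczTerm_le hB
          (by have := Finset.mem_range.mp hs; omega)
    _ = 9 * (B : ℝ) ^ 6 * ∑ s ∈ Finset.range (A + 1), (genPow m s : ℝ) := by
        rw [Finset.mul_sum]
    _ ≤ 9 * (B : ℝ) ^ 6 * (2 * n) := by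
        have h : ∑ s ∈ Finset.range (A + 1), genPow m s ≤ 2 * n := by
          rw [Finset.sum_range_succ]
          have := sum_genPow_le m A
          omega
        gcongr
        exact_mod_cast h
    _ = _ := by ring

end Bounds

variable (m) in
/-- A majorant of the Marcinkiewicz-Fejér kernels of index `n`, `genPow m T ≤ n < genPow m N`. -/
def kernelMajorant (B N T : ℕ) (x y : Group m) : ℝ :=
  ∑ s ∈ Finset.range N, (genPow m (max s T) : ℝ)⁻¹ * marcinkiewiczTerm m B s x y

omit [∀ k, (m k).AtLeastTwo] in
theorem kernelMajorant_nonneg (B N T : ℕ) (x y : Group m) : 0 ≤ kernelMajorant m B N T x y :=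
  Finset.sum_nonneg fun s _ => mul_nonneg (by positivity) (marcinkiewiczTerm_nonneg B s x y)

theorem sum_succ_mul_half_pow (n : ℕ) :
    ∑ k ∈ Finset.range n, ((k : ℝ) + 1) * (1 / 2) ^ k = 4 - (2 * n + 4) * (1 / 2) ^ n := by
  induction n with
  | zero => norm_num
  | succ n ih =>
    rw [Finset.sum_range_succ, ih]
    push_cast
    ring

theorem two_pow_mul_genPow_le (T k : ℕ) : 2 ^ k * genPow m T ≤ genPow m (T + k) := by
  induction k with
  | zero => simp
  | succ k ih =>
    have := two_mul_genPow_le m (T + k)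
    rw [pow_succ, ← add_assoc]
    linarith

section Bounds

variable {B : ℕ} (hB : ∀ k, m k ≤ B) {N : ℕ}
include hB

/-- Every index `s` that occurs satisfies `M_s ≤ n`, and `M_T ≤ n` as well, so `1 / n` may be
replaced by `1 / M_{max(s,T)}`, which is free of `n`. -/
theorem norm_marcinkiewicz_div_le {n T : ℕ} (hTn : genPow m T ≤ n) (hnN : n < genPow m N)
    (x y : Group m) : (n : ℝ)⁻¹ * ‖marcinkiewicz m n x y‖ ≤ kernelMajorant m B N T x y := by
  have hn : 1 ≤ n := (genPow_pos m T).trans_le hTn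
  obtain ⟨A, hA, hA'⟩ := exists_genPow_le_lt (m := m) hn
  have hAN : A < N := by
    by_contra! h
    have := genPow_mono m h
    omega
  have hTA : T ≤ A := by
    by_contra! h
    have := genPow_mono m (Nat.succ_le_of_lt h)
    simp only [Nat.succ_eq_add_one] at this
    omega
  calc _ ≤ (n : ℝ)⁻¹ * ∑ s ∈ Finset.range (A + 1), marcinkiewiczTerm m B s x y := by
        gcongr
        exact norm_marcinkiewicz_le hB hA' x y
    _ = ∑ s ∈ Finset.range (A + 1), (n : ℝ)⁻¹ * marcinkiewiczTerm m B s x y := by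
        rw [Finset.mul_sum]
    _ ≤ ∑ s ∈ Finset.range (A + 1),
        (genPow m (max s T) : ℝ)⁻¹ * marcinkiewiczTerm m B s x y := by
        refine Finset.sum_le_sum fun s hs => ?_
        have h1 := marcinkiewiczTerm_nonneg B s x y
        have h2 := genPow_cast_pos (m := m) (max s T)
        have h3 : genPow m (max s T) ≤ n := (genPow_mono m
          (by have := Finset.mem_range.mp hs; omega : max s T ≤ A)).trans hA
        gcongr
    _ ≤ _ := Finset.sum_le_sum_of_subset_of_nonneg
        (Finset.range_subset_range.mpr (by omega)) fun s _ _ =>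
          mul_nonneg (by positivity) (marcinkiewiczTerm_nonneg B s x y)

/-- Indices below `T` contribute `9 * B ^ 6`, since the `M_s` with `s < T` sum to at most `M_T`. For
`s = T + k` the contribution is at most `9 * B ^ 6 * (k + 1) / 2 ^ k`, with total at most `36 * B ^
6`. -/
theorem mean_mean_kernelMajorant_mul_outsideSq_le {T : ℕ} (hT : T ≤ N) :
    mean N (fun x => mean N fun y => kernelMajorant m B N T x y * outsideSq T x y) ≤
      45 * B ^ 6 := by
  obtain ⟨D, rfl⟩ := Nat.exists_eq_add_of_le hT
  simp_rw [kernelMajorant, Finset.sum_mul, mean_sum, mul_assoc, mean_const_mul]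
  rw [Finset.sum_range_add]
  have h1 : ∑ s ∈ Finset.range T, (genPow m (max s T) : ℝ)⁻¹ * mean (T + D) (fun x =>
      mean (T + D) fun y => marcinkiewiczTerm m B s x y * outsideSq T x y) ≤ 9 * B ^ 6 := by
    calc _ ≤ ∑ s ∈ Finset.range T, (genPow m T : ℝ)⁻¹ * (9 * B ^ 6 * genPow m s) := by
          refine Finset.sum_le_sum fun s hs => ?_
          have hs' := Finset.mem_range.mp hs
          rw [max_eq_right hs'.le]
          gcongr
          exact (mean_mono fun x => mean_mono fun y => mul_le_of_le_one_right
            (marcinkiewiczTerm_nonneg B s x y) (outsideSq_le_one T x y)).trans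
            (mean_mean_marcinkiewiczTerm_le hB (by omega))
      _ = (genPow m T : ℝ)⁻¹ * (9 * B ^ 6 * ∑ s ∈ Finset.range T, (genPow m s : ℝ)) := by
          rw [Finset.mul_sum, Finset.mul_sum]
      _ ≤ (genPow m T : ℝ)⁻¹ * (9 * B ^ 6 * genPow m T) := by
          gcongr
          exact_mod_cast sum_genPow_le m T
      _ = _ := by
          field_simp [(genPow_cast_pos (m := m) T).ne']
  have h2 : ∑ k ∈ Finset.range D, (genPow m (max (T + k) T) : ℝ)⁻¹ * mean (T + D) (fun x =>
      mean (T + D) fun y => marcinkiewiczTerm m B (T + k) x y * outsideSq T x y) ≤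
      36 * B ^ 6 := by
    calc _ ≤ ∑ k ∈ Finset.range D, 9 * (B : ℝ) ^ 6 * (((k : ℝ) + 1) * (1 / 2) ^ k) := by
          refine Finset.sum_le_sum fun k hk => ?_
          have hk' := Finset.mem_range.mp hk
          rw [max_eq_left (Nat.le_add_right T k), inv_mul_le_iff₀ (genPow_cast_pos _)]
          refine (mean_mean_marcinkiewiczTerm_mul_outsideSq_le hB (Nat.le_add_right T k)
            (by omega)).trans ?_
          have h3 : (2 : ℝ) ^ k * genPow m T ≤ genPow m (T + k) := by
            exact_mod_cast two_pow_mul_genPow_le T k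
          have h4 : (genPow m T : ℝ) ≤ genPow m (T + k) * (1 / 2) ^ k := by
            rw [one_div, inv_pow, ← div_eq_mul_inv, le_div_iff₀ (by positivity), mul_comm]
            exact h3
          push_cast
          calc 9 * (B : ℝ) ^ 6 * ((T + k - T + 1) * genPow m T)
              = 9 * (B : ℝ) ^ 6 * (k + 1) * genPow m T := by ring
            _ ≤ 9 * (B : ℝ) ^ 6 * (k + 1) * (genPow m (T + k) * (1 / 2) ^ k) := by gcongr
            _ = _ := by ring
      _ = 9 * (B : ℝ) ^ 6 * (4 - (2 * D + 4) * (1 / 2) ^ D) := by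
          rw [← Finset.mul_sum, sum_succ_mul_half_pow]
      _ ≤ 9 * (B : ℝ) ^ 6 * 4 := by
          gcongr
          have : (0 : ℝ) ≤ (2 * D + 4) * (1 / 2) ^ D := by positivity
          linarith
      _ = _ := by ring
  linarith

end Bounds

end Vilenkin

end

/-! ### The weak type inequality on finite products and its transfer to the Vilenkin group. -/

noncomputable section

namespace Vilenkin

variable {m : ℕ → ℕ}

variable (m) in
/-- The pairs in the finite product whose first `T` coordinates vanish. -/
def vanishing (N T : ℕ) : AddSubgroup (FinGroup m N × FinGroup m N) where
  carrier := {w | ∀ k < T, extend m N w.1 k = 0 ∧ extend m N w.2 k = 0}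
  zero_mem' := by simp
  add_mem' := by
    intro v w hv hw k hk
    simp [hv k hk, hw k hk]
  neg_mem' := by
    intro w hw k hk
    simp [hw k hk]

theorem mem_vanishing {N T : ℕ} {w : FinGroup m N × FinGroup m N} :
    w ∈ vanishing m N T ↔ ∀ k < T, extend m N w.1 k = 0 ∧ extend m N w.2 k = 0 := Iff.rfl

theorem vanishing_antitone (N : ℕ) : Antitone (vanishing m N) :=
  fun _ _ h _ hw k hk => hw k (hk.trans_le h)

theorem vanishing_zero (N : ℕ) : vanishing m N 0 = ⊤ := by
  ext w
  simp [mem_vanishing]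

theorem vanishing_self (N : ℕ) : vanishing m N N = ⊥ := by
  ext w
  rw [mem_vanishing, AddSubgroup.mem_bot]
  constructor
  · intro h
    refine Prod.ext (funext fun k => ?_) (funext fun k => ?_)
    · simpa [extend_of_lt k.2] using (h k k.2).1
    · simpa [extend_of_lt k.2] using (h k k.2).2
  · rintro rfl
    simp

/-- The smaller subgroup is the kernel, inside the larger one, of reading off the `T`-th
coordinates, so the index is at most `m T ^ 2`. -/
theorem card_vanishing_le [∀ k, (m k).AtLeastTwo] {B : ℕ} (hB : ∀ k, m k ≤ B) (N T : ℕ) :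
    (Nat.card (vanishing m N T) : ℝ) ≤ B ^ 2 * Nat.card (vanishing m N (T + 1)) := by
  let φ : FinGroup m N × FinGroup m N →+ ZMod (m T) × ZMod (m T) :=
    ((Pi.evalAddMonoidHom _ T).comp (extend m N)).prodMap
      ((Pi.evalAddMonoidHom _ T).comp (extend m N))
  have hφ : vanishing m N (T + 1) = φ.ker ⊓ vanishing m N T := by
    ext w
    simp only [AddSubgroup.mem_inf, mem_vanishing, AddMonoidHom.mem_ker, φ,
      AddMonoidHom.coe_prodMap, Prod.map, Prod.mk_eq_zero]
    exact ⟨fun h => ⟨h T T.lt_succ_self, fun k hk => h k (by omega)⟩, fun h k hk =>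
      (Nat.lt_succ_iff_lt_or_eq.mp hk).elim (h.2 k) (fun hk => hk ▸ h.1)⟩
  have h1 := AddSubgroup.relIndex_mul_relIndex ⊥ (vanishing m N (T + 1)) (vanishing m N T) bot_le
    (vanishing_antitone N T.le_succ)
  rw [AddSubgroup.relIndex_bot_left, AddSubgroup.relIndex_bot_left] at h1
  have h2 : (vanishing m N (T + 1)).relIndex (vanishing m N T) ≤ B ^ 2 := by
    rw [hφ, AddSubgroup.inf_relIndex_right, AddSubgroup.relIndex_ker]
    calc _ ≤ Nat.card (ZMod (m T) × ZMod (m T)) :=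
          Nat.card_le_card_of_injective _ Subtype.val_injective
      _ = m T * m T := by rw [Nat.card_prod, Nat.card_zmod]
      _ ≤ B ^ 2 := by rw [sq]; exact Nat.mul_le_mul (hB T) (hB T)
  rw [← h1]
  push_cast
  rw [mul_comm]
  gcongr
  exact_mod_cast h2

variable [∀ k, (m k).AtLeastTwo]

theorem mean_mean_eq (N : ℕ) (φ : Group m → Group m → ℝ) :
    mean N (fun x => mean N (φ x)) = ∑ w : FinGroup m N × FinGroup m N,
      ((genPow m N : ℝ) ^ 2)⁻¹ * φ (extend m N w.1) (extend m N w.2) := by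
  rw [Fintype.sum_prod_type]
  simp only [mean, ← Finset.mul_sum]
  rw [← mul_assoc]
  congr 1
  rw [sq, mul_inv]

open scoped Classical in
/-- The weak type inequality for the Marcinkiewicz-Fejér kernels on a finite product. -/
theorem mul_card_maximal_le {B : ℕ} (hB : ∀ k, m k ≤ B) (N : ℕ)
    (c : FinGroup m N × FinGroup m N → ℂ) {t : ℝ} (ht : 0 < t) :
    t * (((Finset.univ : Finset (FinGroup m N × FinGroup m N)).filter fun w =>
      ∃ n, 1 ≤ n ∧ n < genPow m N ∧ (45 * (B : ℝ) ^ 8 + 1) * t <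
        ‖(n : ℂ)⁻¹ * ∑ q, c q * marcinkiewicz m n (extend m N (w.1 - q.1))
          (extend m N (w.2 - q.2))‖).card / (genPow m N : ℝ) ^ 2) ≤
      (1 + 90 * (B : ℝ) ^ 6) * ∑ q, ‖c q‖ := by
  have hM := genPow_cast_pos (m := m) N
  have hM2 : (0 : ℝ) < (genPow m N : ℝ) ^ 2 := by positivity
  have hMC : (genPow m N : ℂ) ≠ 0 := Nat.cast_ne_zero.mpr (genPow_pos m N).ne'
  -- The factor `M_N ^ (-2)` turns sums over the group into means; it is undone by applying the
  -- abstract inequality to `M_N ^ 2 * c`.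
  let K : {n : ℕ // 1 ≤ n ∧ n < genPow m N} → FinGroup m N × FinGroup m N → ℂ := fun n w =>
    ((genPow m N : ℂ) ^ 2)⁻¹ * ((n : ℂ)⁻¹ *
      marcinkiewicz m n (extend m N w.1) (extend m N w.2))
  let L : ℕ → FinGroup m N × FinGroup m N → ℝ := fun T w =>
    ((genPow m N : ℝ) ^ 2)⁻¹ * kernelMajorant m B N T (extend m N w.1) (extend m N w.2)
  have hnorm : ∀ n w, ‖K n w‖ = ((genPow m N : ℝ) ^ 2)⁻¹ * (((n : ℕ) : ℝ)⁻¹ *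
      ‖marcinkiewicz m n (extend m N w.1) (extend m N w.2)‖) := fun n w => by
    simp [K]
  have hK : ∀ n, ∑ w, ‖K n w‖ ≤ 45 * (B : ℝ) ^ 6 := fun n => by
    simp_rw [hnorm]
    have hn : (0 : ℝ) < (n : ℕ) := Nat.cast_pos.mpr n.2.1
    rw [← mean_mean_eq N fun x y => ((n : ℕ) : ℝ)⁻¹ * ‖marcinkiewicz m n x y‖]
    simp_rw [mean_const_mul]
    rw [inv_mul_le_iff₀ hn]
    refine (mean_mean_norm_marcinkiewicz_le_mul hB n.2.1 n.2.2).trans ?_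
    have : (0 : ℝ) ≤ B ^ 6 * (n : ℕ) := by positivity
    linarith
  have hL : ∀ T ≤ N, ∑ w, (if w ∈ vanishing m N T then 0 else L T w) ≤ 45 * (B : ℝ) ^ 6 := by
    intro T hT
    refine le_of_eq_of_le ?_ (mean_mean_kernelMajorant_mul_outsideSq_le hB hT)
    rw [mean_mean_eq N fun x y => kernelMajorant m B N T x y * outsideSq T x y]
    refine Finset.sum_congr rfl fun w _ => ?_
    have : w ∈ vanishing m N T ↔
        (∀ k < T, extend m N w.1 k = 0) ∧ ∀ k < T, extend m N w.2 k = 0 :=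
      ⟨fun h => ⟨fun k hk => (h k hk).1, fun k hk => (h k hk).2⟩,
        fun h k hk => ⟨h.1 k hk, h.2 k hk⟩⟩
    simp only [this, outsideSq, L]
    split_ifs <;> simp
  have key := CosetDecomposition.mul_card_maximal_le (vanishing_antitone (m := m) N)
    (vanishing_zero N) (vanishing_self N) (R := (B : ℝ) ^ 2) (one_le_pow₀ (one_le_bound hB))
    (card_vanishing_le hB N) (C := 45 * (B : ℝ) ^ 6) (by positivity) hK
    (L := L) (fun T w => mul_nonneg (by positivity) (kernelMajorant_nonneg B N T _ _)) hL
    (fun n T hT => by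
      -- For `n ≤ M_T` only characters of the first `T` coordinates enter the kernel; for `n ≥ M_T`
      -- the majorant applies.
      rcases le_total (n : ℕ) (genPow m T) with h | h
      · refine Or.inl fun w v hv => ?_
        simp only [K]
        congr 2
        refine marcinkiewicz_congr h (fun k hk => ?_) (fun k hk => ?_)
        · simp [(hv k hk).1]
        · simp [(hv k hk).2]
      · refine Or.inr fun w => ?_
        rw [hnorm]
        simp only [L]
        gcongr
        exact norm_marcinkiewicz_div_le hB h n.2.2 _ _)
    (fun q => (genPow m N : ℂ) ^ 2 * c q) ht
  have hsum : ∀ (n : {n : ℕ // 1 ≤ n ∧ n < genPow m N}) w,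
      ∑ q, (genPow m N : ℂ) ^ 2 * c q * K n (w - q) = ((n : ℕ) : ℂ)⁻¹ *
        ∑ q, c q * marcinkiewicz m n (extend m N (w.1 - q.1)) (extend m N (w.2 - q.2)) := by
    intro n w
    rw [Finset.mul_sum]
    refine Finset.sum_congr rfl fun q _ => ?_
    simp only [K, Prod.fst_sub, Prod.snd_sub]
    field_simp
  simp_rw [hsum, norm_mul _ (c _), norm_pow, Complex.norm_natCast, ← Finset.mul_sum] at key
  rw [← mul_div_assoc, div_le_iff₀ hM2]
  refine le_of_eq_of_le ?_ (key.trans_eq (by ring))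
  congr 2
  refine congrArg Finset.card (Finset.filter_congr fun w _ => ?_)
  have h8 : 45 * (B : ℝ) ^ 6 * B ^ 2 + 1 = 45 * (B : ℝ) ^ 8 + 1 := by ring
  rw [h8, Subtype.exists]
  exact exists_congr fun n => ⟨fun h => ⟨⟨h.1, h.2.1⟩, h.2.2⟩, fun ⟨h, h'⟩ => ⟨h.1, h.2, h'⟩⟩

/-- The measure on the square of the Vilenkin group. -/
abbrev haarSq (m : ℕ → ℕ) [∀ k, (m k).AtLeastTwo] : Measure (Group m × Group m) :=
  (haar m).prod (haar m)

instance : IsProbabilityMeasure (haar m) := by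
  unfold haar
  infer_instance

variable (m) in
/-- The projection to the square of the product of the first `N` factors. -/
def proj (N : ℕ) (p : Group m × Group m) : FinGroup m N × FinGroup m N :=
  (fun k => p.1 k, fun k => p.2 k)

omit [∀ k, (m k).AtLeastTwo] in
theorem measurable_proj (N : ℕ) : Measurable (proj m N) := by
  unfold proj
  fun_prop

omit [∀ k, (m k).AtLeastTwo] in
theorem proj_eq_iff {N : ℕ} {p : Group m × Group m} {w : FinGroup m N × FinGroup m N} :
    proj m N p = w ↔ ∀ k < N, p.1 k = extend m N w.1 k ∧ p.2 k = extend m N w.2 k := by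
  constructor
  · rintro rfl k hk
    simp [proj, extend_of_lt hk]
  · intro h
    refine Prod.ext (funext fun k => ?_) (funext fun k => ?_)
    · simpa [proj, extend_of_lt k.2] using (h k k.2).1
    · simpa [proj, extend_of_lt k.2] using (h k k.2).2

theorem haar_cylinder (N : ℕ) (u : FinGroup m N) :
    haar m {x | ∀ k < N, x k = extend m N u k} = (genPow m N : ℝ≥0∞)⁻¹ := by
  have h : {x : Group m | ∀ k < N, x k = extend m N u k} =
      Set.pi (Finset.range N) fun k => {extend m N u k} := by
    ext x
    simp [Set.mem_pi]
  rw [h, haar, Measure.infinitePi_pi _ (fun _ _ => MeasurableSet.singleton _)]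
  have h1 : ∀ k, coordMeasure m k {extend m N u k} = (m k : ℝ≥0∞)⁻¹ := fun k => by
    simp [coordMeasure]
  simp_rw [h1]
  clear h u h1
  induction N with
  | zero => simp [genPow]
  | succ N ih =>
    rw [Finset.prod_range_succ, ih, genPow_succ, Nat.cast_mul, mul_comm,
      ENNReal.mul_inv (Or.inr (ENNReal.natCast_ne_top _)) (Or.inl (ENNReal.natCast_ne_top _))]

theorem haarSq_fiber (N : ℕ) (w : FinGroup m N × FinGroup m N) :
    haarSq m (proj m N ⁻¹' {w}) = ((genPow m N : ℝ≥0∞) ^ 2)⁻¹ := by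
  have : proj m N ⁻¹' {w} = {x | ∀ k < N, x k = extend m N w.1 k} ×ˢ
      {x | ∀ k < N, x k = extend m N w.2 k} := by
    ext p
    rw [Set.mem_preimage, Set.mem_singleton_iff, proj_eq_iff]
    exact ⟨fun h => ⟨fun k hk => (h k hk).1, fun k hk => (h k hk).2⟩,
      fun h k hk => ⟨h.1 k hk, h.2 k hk⟩⟩
  rw [this, Measure.prod_prod, haar_cylinder, haar_cylinder, ← sq, ENNReal.inv_pow]

theorem haarSq_preimage (N : ℕ) (S : Finset (FinGroup m N × FinGroup m N)) :
    haarSq m (proj m N ⁻¹' S) = ENNReal.ofReal (S.card / (genPow m N : ℝ) ^ 2) := by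
  have h : proj m N ⁻¹' S = ⋃ w ∈ S, proj m N ⁻¹' {w} := by
    ext p
    simp
  rw [h, measure_biUnion_finset (fun v _ w _ hvw => Disjoint.preimage _ (by simpa using hvw))
    (fun w _ => measurable_proj N (MeasurableSet.singleton w))]
  simp_rw [haarSq_fiber]
  rw [Finset.sum_const, nsmul_eq_mul, ENNReal.ofReal_div_of_pos (by
    have := genPow_cast_pos (m := m) N; positivity), ENNReal.ofReal_natCast,
    ENNReal.ofReal_pow (by positivity), ENNReal.ofReal_natCast, div_eq_mul_inv]

theorem integral_eq_sum_fiber {E : Type*} [NormedAddCommGroup E] [NormedSpace ℝ E]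
    {g : Group m × Group m → E} (hg : Integrable g (haarSq m)) (N : ℕ) :
    ∫ p, g p ∂haarSq m = ∑ w, ∫ p in proj m N ⁻¹' {w}, g p ∂haarSq m := by
  rw [← integral_iUnion_fintype (fun w => measurable_proj N (MeasurableSet.singleton w))
    (fun v w hvw => Disjoint.preimage _ (by simpa using hvw)) (fun w => hg.integrableOn)]
  have : ⋃ w, proj m N ⁻¹' {w} = Set.univ := by
    ext p
    simp
  rw [this, setIntegral_univ]

/-- The integral of `f` over the cylinder determined by `w`. -/
def fiberIntegral (f : Group m × Group m → ℂ) (N : ℕ) (w : FinGroup m N × FinGroup m N) : ℂ :=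
  ∫ p in proj m N ⁻¹' {w}, f p ∂haarSq m

theorem sum_norm_fiberIntegral_le {f : Group m × Group m → ℂ} (hf : Integrable f (haarSq m))
    (N : ℕ) : ∑ w, ‖fiberIntegral f N w‖ ≤ ∫ p, ‖f p‖ ∂haarSq m := by
  rw [integral_eq_sum_fiber hf.norm N]
  exact Finset.sum_le_sum fun w _ => norm_integral_le_integral_norm _

theorem measurable_psi (n : ℕ) : Measurable (psi m n) := by
  have : psi m n = fun x => ∏ k ∈ Finset.range n, (ZMod.stdAddChar (x k) : ℂ) ^ digit m n k := by
    ext x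
    simp only [psi_eq_prod (lt_genPow m n), rademacher_eq]
  rw [this]
  refine Finset.measurable_prod _ fun k _ => Measurable.pow_const ?_ _
  exact (measurable_of_finite (fun z : ZMod (m k) => (ZMod.stdAddChar z : ℂ))).comp
    (measurable_pi_apply k)

theorem integrable_mul_psi {f : Group m × Group m → ℂ} (hf : Integrable f (haarSq m)) (i j : ℕ) :
    Integrable (fun p => f p * conj (psi m i p.1) * conj (psi m j p.2)) (haarSq m) := by
  have hi : Measurable fun p : Group m × Group m => conj (psi m i p.1) :=
    (continuous_star.measurable.comp (measurable_psi i)).comp measurable_fst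
  have hj : Measurable fun p : Group m × Group m => conj (psi m j p.2) :=
    (continuous_star.measurable.comp (measurable_psi j)).comp measurable_snd
  refine (hf.mul_bdd (c := 1) hi.aestronglyMeasurable (ae_of_all _ fun p => ?_)).mul_bdd (c := 1)
    hj.aestronglyMeasurable (ae_of_all _ fun p => ?_)
  · rw [RCLike.norm_conj, norm_psi]
  · rw [RCLike.norm_conj, norm_psi]

theorem fourierCoeff_eq_sum {f : Group m × Group m → ℂ} (hf : Integrable f (haarSq m))
    {N i j : ℕ} (hi : i < genPow m N) (hj : j < genPow m N) :
    fourierCoeff m f i j = ∑ w : FinGroup m N × FinGroup m N,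
      fiberIntegral f N w * conj (psi m i (extend m N w.1)) *
        conj (psi m j (extend m N w.2)) := by
  rw [fourierCoeff, integral_eq_sum_fiber (integrable_mul_psi hf i j) N]
  refine Finset.sum_congr rfl fun w _ => ?_
  rw [fiberIntegral, mul_assoc, ← integral_mul_const]
  refine setIntegral_congr_fun (measurable_proj N (MeasurableSet.singleton w)) fun p hp => ?_
  have hp' := proj_eq_iff.mp (show proj m N p = w from hp)
  rw [psi_congr hi fun k hk => (hp' k hk).1, psi_congr hj fun k hk => (hp' k hk).2, mul_assoc]

theorem partialSum_eq_sum {f : Group m × Group m → ℂ} (hf : Integrable f (haarSq m))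
    {N j : ℕ} (hj : j ≤ genPow m N) (x y : Group m) :
    partialSum m f j j x y = ∑ w : FinGroup m N × FinGroup m N, fiberIntegral f N w *
      (dirichlet m j (x - extend m N w.1) * dirichlet m j (y - extend m N w.2)) := by
  have h : ∀ i ∈ Finset.range j, ∀ l ∈ Finset.range j,
      fourierCoeff m f i l * psi m i x * psi m l y = ∑ w : FinGroup m N × FinGroup m N,
        fiberIntegral f N w * (psi m i (x - extend m N w.1) * psi m l (y - extend m N w.2)) :=
    fun i hi l hl => by
      rw [fourierCoeff_eq_sum hf ((Finset.mem_range.mp hi).trans_le hj)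
        ((Finset.mem_range.mp hl).trans_le hj), Finset.sum_mul, Finset.sum_mul]
      refine Finset.sum_congr rfl fun w _ => ?_
      rw [psi_sub, psi_sub]
      ring
  rw [partialSum, Finset.sum_congr rfl fun i hi => Finset.sum_congr rfl (h i hi)]
  simp_rw [dirichlet, Finset.sum_mul_sum, Finset.mul_sum]
  rw [Finset.sum_comm]
  conv_lhs => enter [2, l]; rw [Finset.sum_comm]
  rw [Finset.sum_comm]
  exact Finset.sum_congr rfl fun w _ => Finset.sum_comm

/-- All characters involved are constant on the cylinders of level `N`, so only the integrals of `f`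
over these cylinders matter. -/
theorem marcinkiewiczFejer_eq_sum {f : Group m × Group m → ℂ} (hf : Integrable f (haarSq m))
    {N n : ℕ} (hn : n ≤ genPow m N) (p : Group m × Group m) :
    marcinkiewiczFejer m f n p.1 p.2 = (n : ℂ)⁻¹ * ∑ w, fiberIntegral f N w *
      marcinkiewicz m n (extend m N ((proj m N p).1 - w.1))
        (extend m N ((proj m N p).2 - w.2)) := by
  rw [marcinkiewiczFejer, one_div]
  congr 1
  rw [Finset.sum_congr rfl fun j hj =>
    partialSum_eq_sum hf ((Finset.mem_range.mp hj).le.trans hn) p.1 p.2, Finset.sum_comm]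
  refine Finset.sum_congr rfl fun w _ => ?_
  rw [← Finset.mul_sum]
  congr 1
  have hp := proj_eq_iff.mp (rfl : proj m N p = proj m N p)
  refine marcinkiewicz_congr hn (x := p.1 - extend m N w.1) (y := p.2 - extend m N w.2)
    (fun k hk => ?_) (fun k hk => ?_)
  · simp [(hp k hk).1]
  · simp [(hp k hk).2]

/-- The maximal operator of the Marcinkiewicz-Fejér means is of weak type `(1, 1)`. -/
theorem measure_maximal_le {B : ℕ} (hB : ∀ k, m k ≤ B) {f : Group m × Group m → ℂ}
    (hf : Integrable f (haarSq m)) {t : ℝ} (ht : 0 < t) :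
    haarSq m {p | ∃ n, 1 ≤ n ∧ (45 * (B : ℝ) ^ 8 + 1) * t < ‖marcinkiewiczFejer m f n p.1 p.2‖} ≤
      ENNReal.ofReal ((1 + 90 * (B : ℝ) ^ 6) * (∫ p, ‖f p‖ ∂haarSq m) / t) := by
  classical
  -- These sets increase to the full exceptional set, and each is a union of cylinders of level `N`
  -- with a bound independent of `N`.
  let A : ℕ → Set (Group m × Group m) := fun N => {p | ∃ n, 1 ≤ n ∧ n < genPow m N ∧
    (45 * (B : ℝ) ^ 8 + 1) * t < ‖marcinkiewiczFejer m f n p.1 p.2‖}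
  have hA : Monotone A := fun N N' h p ⟨n, h1, h2, h3⟩ => ⟨n, h1, h2.trans_le (genPow_mono m h), h3⟩
  have hU : {p : Group m × Group m | ∃ n, 1 ≤ n ∧
      (45 * (B : ℝ) ^ 8 + 1) * t < ‖marcinkiewiczFejer m f n p.1 p.2‖} = ⋃ N, A N := by
    ext p
    simp only [Set.mem_iUnion]
    exact ⟨fun ⟨n, h1, h3⟩ => ⟨n, n, h1, lt_genPow m n, h3⟩,
      fun ⟨N, n, h1, _, h3⟩ => ⟨n, h1, h3⟩⟩
  rw [hU, hA.measure_iUnion]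
  refine iSup_le fun N => ?_
  have hAN : A N = proj m N ⁻¹' (((Finset.univ : Finset (FinGroup m N × FinGroup m N)).filter
      fun w => ∃ n, 1 ≤ n ∧ n < genPow m N ∧ (45 * (B : ℝ) ^ 8 + 1) * t <
        ‖(n : ℂ)⁻¹ * ∑ q, fiberIntegral f N q * marcinkiewicz m n (extend m N (w.1 - q.1))
          (extend m N (w.2 - q.2))‖ : Finset _) : Set _) := by
    ext p
    simp only [Set.mem_preimage, Finset.coe_filter, Finset.mem_univ, true_and]
    refine exists_congr fun n => and_congr_right fun _ => and_congr_right fun h2 => ?_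
    rw [marcinkiewiczFejer_eq_sum hf h2.le]
  rw [hAN, haarSq_preimage]
  refine ENNReal.ofReal_le_ofReal ?_
  rw [le_div_iff₀' ht]
  refine (mul_card_maximal_le hB N (fiberIntegral f N) ht).trans ?_
  gcongr
  exact sum_norm_fiberIntegral_le hf N

end Vilenkin

end

/-! ### Density of functions of finitely many coordinates, and convergence almost everywhere. -/

noncomputable section

namespace Vilenkin

variable {m : ℕ → ℕ}

/-- A function on the square that depends on the first `K` coordinates of both variables only. -/
def DependsBelowSq {α : Type*} (K : ℕ) (g : Group m × Group m → α) : Prop :=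
  ∀ p q, proj m K p = proj m K q → g p = g q

variable (m) in
/-- The filtration of the square generated by the projections to the finite products. -/
def projFiltration : Filtration ℕ (inferInstance : MeasurableSpace (Group m × Group m)) where
  seq N := MeasurableSpace.comap (proj m N) inferInstance
  mono' N N' h := by
    let r : FinGroup m N' × FinGroup m N' → FinGroup m N × FinGroup m N := fun w =>
      (fun k => w.1 (Fin.castLE h k), fun k => w.2 (Fin.castLE h k))
    have hr : Measurable r := by fun_prop
    have : proj m N = r ∘ proj m N' := rfl
    simp only [this, ← MeasurableSpace.comap_comp]
    exact MeasurableSpace.comap_mono hr.comap_le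
  le' N := (measurable_proj N).comap_le

theorem iSup_projFiltration :
    ⨆ N, (projFiltration m) N = (inferInstance : MeasurableSpace (Group m × Group m)) := by
  refine le_antisymm (iSup_le (projFiltration m).le) ?_
  have h : ∀ k, Measurable[⨆ N, (projFiltration m) N] fun p : Group m × Group m =>
      (p.1 k, p.2 k) := fun k => by
    have h1 : Measurable fun w : FinGroup m (k + 1) × FinGroup m (k + 1) =>
        (w.1 (Fin.last k), w.2 (Fin.last k)) := by fun_prop
    have h2 : Measurable[(projFiltration m) (k + 1)] (proj m (k + 1)) := comap_measurable _
    exact (h1.comp h2).mono (le_iSup (projFiltration m) (k + 1)) le_rfl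
  refine sup_le ?_ ?_
  · refine Measurable.comap_le ?_
    exact @measurable_pi_lambda _ _ _ (⨆ N, (projFiltration m) N) _ _
      fun k => measurable_fst.comp (h k)
  · refine Measurable.comap_le ?_
    exact @measurable_pi_lambda _ _ _ (⨆ N, (projFiltration m) N) _ _
      fun k => measurable_snd.comp (h k)

theorem dependsBelowSq_of_measurable {K : ℕ} {g : Group m × Group m → ℝ}
    (hg : Measurable[(projFiltration m) K] g) : DependsBelowSq K g := by
  intro p q hpq
  obtain ⟨S, -, hS⟩ := hg (measurableSet_singleton (g q))
  have hq : q ∈ proj m K ⁻¹' S := by rw [hS]; rfl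
  have hp : p ∈ proj m K ⁻¹' S := by
    rw [Set.mem_preimage, hpq]
    exact hq
  rw [hS] at hp
  exact hp

variable [∀ k, (m k).AtLeastTwo]

/-- Lévy's upward theorem in `L¹`. Having it for all large `K` lets the real and imaginary parts of
a complex function share one `K`. -/
theorem eventually_exists_dependsBelowSq {f : Group m × Group m → ℝ}
    (hf : Integrable f (haarSq m)) {δ : ℝ} (hδ : 0 < δ) :
    ∀ᶠ K in atTop, ∃ g, Integrable g (haarSq m) ∧ DependsBelowSq K g ∧
      ∫ p, ‖f p - g p‖ ∂haarSq m < δ := by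
  have hmk : Integrable (hf.1.mk f) (haarSq m) := hf.congr hf.1.ae_eq_mk
  have h := hmk.tendsto_eLpNorm_condExp (ℱ := projFiltration m)
    (by rw [iSup_projFiltration]; exact hf.1.stronglyMeasurable_mk)
  filter_upwards [(tendsto_order.mp h).2 (ENNReal.ofReal δ) (by simpa using hδ)] with K hK
  refine ⟨(haarSq m)[hf.1.mk f | (projFiltration m) K], integrable_condExp,
    dependsBelowSq_of_measurable stronglyMeasurable_condExp.measurable, ?_⟩
  have hint : Integrable ((haarSq m)[hf.1.mk f | (projFiltration m) K] - hf.1.mk f) (haarSq m) :=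
    integrable_condExp.sub hmk
  have h1 : ∫ p, ‖f p - ((haarSq m)[hf.1.mk f | (projFiltration m) K]) p‖ ∂haarSq m =
      ∫ p, ‖((haarSq m)[hf.1.mk f | (projFiltration m) K] - hf.1.mk f) p‖ ∂haarSq m := by
    refine integral_congr_ae ?_
    filter_upwards [hf.1.ae_eq_mk] with p hp
    rw [Pi.sub_apply, norm_sub_rev, ← hp]
  rw [eLpNorm_one_eq_lintegral_enorm, ← ofReal_integral_norm_eq_lintegral_enorm hint] at hK
  rw [h1]
  exact (ENNReal.ofReal_lt_ofReal_iff hδ).mp hK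

theorem exists_dependsBelowSq_integral_norm_sub_lt {f : Group m × Group m → ℂ}
    (hf : Integrable f (haarSq m)) {δ : ℝ} (hδ : 0 < δ) :
    ∃ K g, Integrable g (haarSq m) ∧ DependsBelowSq K g ∧ ∫ p, ‖f p - g p‖ ∂haarSq m < δ := by
  obtain ⟨K, ⟨u, hui, hu, hfu⟩, v, hvi, hv, hfv⟩ :=
    ((eventually_exists_dependsBelowSq hf.re (half_pos hδ)).and
      (eventually_exists_dependsBelowSq hf.im (half_pos hδ))).exists
  have hgi : Integrable (fun p => (u p : ℂ) + v p * Complex.I) (haarSq m) :=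
    hui.ofReal.add (hvi.ofReal.mul_const _)
  refine ⟨K, fun p => (u p : ℂ) + v p * Complex.I, hgi,
    fun p q h => by simp only [hu p q h, hv p q h], ?_⟩
  calc _ ≤ ∫ p, (‖RCLike.re (f p) - u p‖ + ‖RCLike.im (f p) - v p‖) ∂haarSq m := by
        refine integral_mono (hf.sub hgi).norm ((hf.re.sub hui).norm.add (hf.im.sub hvi).norm)
          fun p => ?_
        have h := Complex.norm_le_abs_re_add_abs_im (f p - ((u p : ℂ) + v p * Complex.I))
        simpa using h
    _ = _ := integral_add (hf.re.sub hui).norm (hf.im.sub hvi).norm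
    _ < δ := by linarith

theorem fiberIntegral_of_dependsBelowSq {K N : ℕ} (hKN : K ≤ N) {g : Group m × Group m → ℂ}
    (hg : DependsBelowSq K g) (w : FinGroup m N × FinGroup m N) :
    fiberIntegral g N w =
      ((genPow m N : ℂ) ^ 2)⁻¹ * g (extend m N w.1, extend m N w.2) := by
  have h : ∀ p ∈ proj m N ⁻¹' {w}, g p = g (extend m N w.1, extend m N w.2) := fun p hp => by
    have hp' := proj_eq_iff.mp (show proj m N p = w from hp)
    refine hg _ _ (Prod.ext (funext fun k => ?_) (funext fun k => ?_))
    · exact (hp' k (k.2.trans_le hKN)).1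
    · exact (hp' k (k.2.trans_le hKN)).2
  rw [fiberIntegral, setIntegral_congr_fun (measurable_proj N (MeasurableSet.singleton w)) h,
    setIntegral_const, measureReal_def, haarSq_fiber, Complex.real_smul]
  simp

/-- The leading digit `a` of `i` sits at some position `A ≥ K`; at the unit vector of coordinate `A`
the character equals `exp (2πi a / m_A)` with `0 < a < m_A`. -/
theorem exists_psi_extend_ne_one {K N i : ℕ} (hi : genPow m K ≤ i) (hiN : i < genPow m N) :
    ∃ e : FinGroup m N, (∀ k < K, extend m N e k = 0) ∧ psi m i (extend m N e) ≠ 1 := by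
  have hi1 : 1 ≤ i := (genPow_pos m K).trans_le hi
  obtain ⟨A, hA, hA'⟩ := exists_genPow_le_lt (m := m) hi1
  have hKA : K ≤ A := by
    by_contra! h
    have := genPow_mono m (Nat.succ_le_of_lt h)
    simp only [Nat.succ_eq_add_one] at this
    omega
  have hAN : A < N := by
    by_contra! h
    have := genPow_mono m h
    omega
  obtain ⟨a, ha, l, hl, rfl⟩ := exists_block m hA'
  have ha0 : a ≠ 0 := by
    rintro rfl
    omega
  have h0 : ∀ k < A, extend m N (Pi.single ⟨A, hAN⟩ 1) k = 0 := fun k hk => by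
    rw [extend_of_lt (hk.trans hAN), Pi.single_eq_of_ne (by simp [Fin.ext_iff, hk.ne])]
  refine ⟨Pi.single ⟨A, hAN⟩ 1, fun k hk => h0 k (hk.trans_le hKA), ?_⟩
  have h1 : psi m l (extend m N (Pi.single ⟨A, hAN⟩ 1)) = psi m l 0 := psi_congr hl h0
  have h2 : psi m l (0 : Group m) = 1 := by
    simp [psi_eq_prod (lt_genPow m l), rademacher_eq]
  have h3 : extend m N (Pi.single ⟨A, hAN⟩ 1 : FinGroup m N) A = 1 := by
    rw [extend_of_lt hAN, Pi.single_eq_same]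
  rw [psi_block ha hl, h1, h2, mul_one, rademacher_eq, h3, ← AddChar.map_nsmul_eq_pow]
  intro h4
  have h5 := ZMod.injective_stdAddChar (h4.trans (AddChar.map_zero_eq_one _).symm)
  rw [nsmul_one, ZMod.natCast_eq_zero_iff] at h5
  exact absurd (Nat.le_of_dvd (Nat.pos_of_ne_zero ha0) h5) (not_le.mpr ha)

/-- Translation by `e` fixes `g` but multiplies the coefficient by a number different from `1`. -/
theorem fourierCoeff_eq_zero_of_translation {K N i j : ℕ} (hKN : K ≤ N) {g : Group m × Group m → ℂ}
    (hg : DependsBelowSq K g) (hgi : Integrable g (haarSq m)) (hi : i < genPow m N)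
    (hj : j < genPow m N) {e : FinGroup m N × FinGroup m N}
    (he : ∀ k < K, extend m N e.1 k = 0 ∧ extend m N e.2 k = 0)
    (hne : psi m i (extend m N e.1) * psi m j (extend m N e.2) ≠ 1) :
    fourierCoeff m g i j = 0 := by
  have h := fourierCoeff_eq_sum hgi hi hj
  have h1 : fourierCoeff m g i j =
      fourierCoeff m g i j * conj (psi m i (extend m N e.1) * psi m j (extend m N e.2)) := by
    conv_lhs => rw [h, ← Equiv.sum_comp (Equiv.addRight e)]
    conv_rhs => rw [h, Finset.sum_mul]
    refine Finset.sum_congr rfl fun w _ => ?_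
    have h2 : fiberIntegral g N (w + e) = fiberIntegral g N w := by
      rw [fiberIntegral_of_dependsBelowSq hKN hg, fiberIntegral_of_dependsBelowSq hKN hg]
      congr 1
      refine hg _ _ (Prod.ext (funext fun k => ?_) (funext fun k => ?_))
      · simp [proj, (he k k.2).1]
      · simp [proj, (he k k.2).2]
    simp only [Equiv.coe_addRight, h2, Prod.fst_add, Prod.snd_add, map_add, psi_add, map_mul]
    ring
  by_contra hc
  rw [left_eq_mul₀ hc] at h1
  refine hne ?_
  rw [← Complex.conj_conj (psi m i (extend m N e.1) * psi m j (extend m N e.2)), h1, map_one]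

theorem fourierCoeff_eq_zero {K i j : ℕ} {g : Group m × Group m → ℂ} (hg : DependsBelowSq K g)
    (hgi : Integrable g (haarSq m)) (hij : genPow m K ≤ i ∨ genPow m K ≤ j) :
    fourierCoeff m g i j = 0 := by
  obtain ⟨N, hKN, hi, hj⟩ : ∃ N, K ≤ N ∧ i < genPow m N ∧ j < genPow m N :=
    ⟨max K (max i j), le_max_left _ _, (lt_genPow m i).trans_le (genPow_mono m (by omega)),
      (lt_genPow m j).trans_le (genPow_mono m (by omega))⟩
  have h0 : ∀ n, psi m n (0 : Group m) = 1 := fun n => by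
    simp [psi_eq_prod (lt_genPow m n), rademacher_eq]
  rcases hij with h | h
  · obtain ⟨e, he, hne⟩ := exists_psi_extend_ne_one h hi
    exact fourierCoeff_eq_zero_of_translation hKN hg hgi hi hj (e := (e, 0))
      (fun k hk => by simp [he k hk]) (by simpa [h0] using hne)
  · obtain ⟨e, he, hne⟩ := exists_psi_extend_ne_one h hj
    exact fourierCoeff_eq_zero_of_translation hKN hg hgi hi hj (e := (0, e))
      (fun k hk => by simp [he k hk]) (by simpa [h0] using hne)

/-- Coefficients beyond `M_K` vanish, and the kernel of the partial sum of order `M_K` is `M_K ^ 2`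
times the indicator of the cylinder around `p`. -/
theorem partialSum_of_dependsBelowSq {K j : ℕ} {g : Group m × Group m → ℂ}
    (hg : DependsBelowSq K g) (hgi : Integrable g (haarSq m)) (hj : genPow m K ≤ j)
    (p : Group m × Group m) : partialSum m g j j p.1 p.2 = g p := by
  have h1 : partialSum m g j j p.1 p.2 = partialSum m g (genPow m K) (genPow m K) p.1 p.2 := by
    have hs := Finset.range_subset_range.mpr hj
    have hc : ∀ i l, i ∉ Finset.range (genPow m K) ∨ l ∉ Finset.range (genPow m K) →
        fourierCoeff m g i l * psi m i p.1 * psi m l p.2 = 0 := fun i l h => by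
      simp only [Finset.mem_range, not_lt] at h
      rw [fourierCoeff_eq_zero hg hgi h, zero_mul, zero_mul]
    unfold partialSum
    rw [← Finset.sum_subset hs fun i _ hi => Finset.sum_eq_zero fun l _ => hc i l (Or.inl hi)]
    exact Finset.sum_congr rfl fun i _ => (Finset.sum_subset hs fun l _ hl =>
      hc i l (Or.inr hl)).symm
  have hM : (genPow m K : ℂ) ≠ 0 := Nat.cast_ne_zero.mpr (genPow_pos m K).ne'
  have hp := proj_eq_iff.mp (rfl : proj m K p = proj m K p)
  rw [h1, partialSum_eq_sum hgi le_rfl, Finset.sum_eq_single (proj m K p)]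
  · rw [fiberIntegral_of_dependsBelowSq le_rfl hg, dirichlet_genPow, dirichlet_genPow,
      if_pos fun k hk => by simp [(hp k hk).1], if_pos fun k hk => by simp [(hp k hk).2],
      hg p (extend m K (proj m K p).1, extend m K (proj m K p).2) (proj_eq_iff.mpr fun _ _ => ⟨rfl, rfl⟩).symm]
    field_simp
  · intro w _ hw
    rw [dirichlet_genPow, dirichlet_genPow]
    split_ifs with hx hy
    · refine absurd (proj_eq_iff.mpr fun k hk => ⟨?_, ?_⟩).symm hw
      · exact sub_eq_zero.mp (hx k hk)
      · exact sub_eq_zero.mp (hy k hk)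
    all_goals simp
  · simp

theorem tendsto_marcinkiewiczFejer_of_dependsBelowSq {K : ℕ} {g : Group m × Group m → ℂ}
    (hg : DependsBelowSq K g) (hgi : Integrable g (haarSq m)) (p : Group m × Group m) :
    Tendsto (fun n => marcinkiewiczFejer m g n p.1 p.2) atTop (𝓝 (g p)) := by
  have h : Tendsto (fun j => partialSum m g j j p.1 p.2) atTop (𝓝 (g p)) :=
    tendsto_const_nhds.congr' ((eventually_ge_atTop (genPow m K)).mono fun j hj =>
      (partialSum_of_dependsBelowSq hg hgi hj p).symm)
  refine h.cesaro_smul.congr fun n => ?_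
  rw [marcinkiewiczFejer, Complex.real_smul]
  simp

theorem marcinkiewiczFejer_sub {f g : Group m × Group m → ℂ} (hf : Integrable f (haarSq m))
    (hg : Integrable g (haarSq m)) (n : ℕ) (x y : Group m) :
    marcinkiewiczFejer m (f - g) n x y =
      marcinkiewiczFejer m f n x y - marcinkiewiczFejer m g n x y := by
  have h : ∀ i j, fourierCoeff m (f - g) i j = fourierCoeff m f i j - fourierCoeff m g i j :=
    fun i j => by
      rw [fourierCoeff, fourierCoeff, fourierCoeff,
        ← integral_sub (integrable_mul_psi hf i j) (integrable_mul_psi hg i j)]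
      simp only [Pi.sub_apply, sub_mul]
  simp only [marcinkiewiczFejer, partialSum, h, sub_mul, Finset.sum_sub_distrib, mul_sub]

/-- Split `f = g + (f - g)` with `g` of finitely many coordinates and `‖f - g‖₁ < δ`. The three
thresholds are for the maximal function of `f - g`, the convergence for `g`, and `|f - g|` itself;
the first and third fail on sets of measure `O(δ / t)`, and `δ` is arbitrary. -/
theorem measure_not_eventually_le {B : ℕ} (hB : ∀ k, m k ≤ B) {f : Group m × Group m → ℂ}
    (hf : Integrable f (haarSq m)) {t : ℝ} (ht : 0 < t) :
    haarSq m {p | ¬ ∀ᶠ n in atTop, ‖marcinkiewiczFejer m f n p.1 p.2 - f p‖ ≤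
      (45 * (B : ℝ) ^ 8 + 1) * t + t + t} = 0 := by
  set E := {p | ¬ ∀ᶠ n in atTop, ‖marcinkiewiczFejer m f n p.1 p.2 - f p‖ ≤
      (45 * (B : ℝ) ^ 8 + 1) * t + t + t} with hE
  set C : ℝ := 1 + 90 * (B : ℝ) ^ 6 with hC
  have hC0 : 0 ≤ C := by positivity
  have key : ∀ δ > 0, haarSq m E ≤ ENNReal.ofReal ((C + 1) * δ / t) := by
    intro δ hδ
    obtain ⟨K, g, hgi, hg, hfg⟩ := exists_dependsBelowSq_integral_norm_sub_lt hf hδ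
    have hsub : E ⊆ {p | ∃ n, 1 ≤ n ∧
        (45 * (B : ℝ) ^ 8 + 1) * t < ‖marcinkiewiczFejer m (f - g) n p.1 p.2‖} ∪
        {p | t ≤ ‖f p - g p‖} := by
      intro p hp
      by_contra hp'
      simp only [Set.mem_union, not_or] at hp'
      obtain ⟨h1, h2⟩ := hp'
      have h1' : ∀ n, 1 ≤ n →
          ‖marcinkiewiczFejer m (f - g) n p.1 p.2‖ ≤ (45 * (B : ℝ) ^ 8 + 1) * t := fun n hn => by
        by_contra! h
        exact h1 ⟨n, hn, h⟩
      have h2' : ‖f p - g p‖ < t := not_le.mp h2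
      refine hp ?_
      have h3 := (tendsto_iff_norm_sub_tendsto_zero.mp
        (tendsto_marcinkiewiczFejer_of_dependsBelowSq hg hgi p))
      filter_upwards [eventually_ge_atTop 1, h3.eventually (gt_mem_nhds ht)] with n hn hn'
      have h4 : marcinkiewiczFejer m f n p.1 p.2 - f p =
          marcinkiewiczFejer m (f - g) n p.1 p.2 +
            (marcinkiewiczFejer m g n p.1 p.2 - g p) + -(f p - g p) := by
        rw [marcinkiewiczFejer_sub hf hgi]
        ring
      rw [h4]
      refine norm_add₃_le.trans ?_
      rw [norm_neg]
      linarith [h1' n hn]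
    have hm1 := measure_maximal_le hB (hf.sub hgi) ht
    have hm2 : haarSq m {p | t ≤ ‖f p - g p‖} ≤ ENNReal.ofReal (δ / t) := by
      rw [← ofReal_measureReal]
      refine ENNReal.ofReal_le_ofReal ?_
      rw [le_div_iff₀' ht]
      exact (mul_meas_ge_le_integral_of_nonneg (ae_of_all _ fun _ => norm_nonneg _)
        (hf.sub hgi).norm t).trans hfg.le
    calc haarSq m E ≤ _ := measure_mono hsub
      _ ≤ _ := measure_union_le _ _
      _ ≤ ENNReal.ofReal (C * δ / t) + ENNReal.ofReal (δ / t) := by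
          refine add_le_add (hm1.trans (ENNReal.ofReal_le_ofReal ?_)) hm2
          gcongr
          exact hfg.le
      _ = _ := by
          rw [← ENNReal.ofReal_add (by positivity) (by positivity)]
          congr 1
          ring
  have hlim : Tendsto (fun δ : ℝ => ENNReal.ofReal ((C + 1) * δ / t)) (𝓝[>] 0) (𝓝 0) := by
    have : Tendsto (fun δ : ℝ => ENNReal.ofReal ((C + 1) * δ / t)) (𝓝 0)
        (𝓝 (ENNReal.ofReal ((C + 1) * 0 / t))) :=
      (ENNReal.continuous_ofReal.comp (by fun_prop : Continuous fun δ : ℝ =>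
        (C + 1) * δ / t)).tendsto 0
    simpa using this.mono_left nhdsWithin_le_nhds
  exact le_antisymm (ge_of_tendsto hlim (eventually_nhdsWithin_of_forall key)) zero_le

end Vilenkin

end

theorem corollary2 (m : ℕ → ℕ) [∀ k, (m k).AtLeastTwo] (hm : BddAbove (Set.range m))
    (f : Vilenkin.Group m × Vilenkin.Group m → ℂ)
    (hf : Integrable f ((Vilenkin.haar m).prod (Vilenkin.haar m))) :
    ∀ᵐ p ∂((Vilenkin.haar m).prod (Vilenkin.haar m)),
      Tendsto (fun n : ℕ => Vilenkin.marcinkiewiczFejer m f n p.1 p.2) atTop (𝓝 (f p)) := by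
  obtain ⟨B, hB⟩ := hm
  have hB' : ∀ k, m k ≤ B := fun k => hB ⟨k, rfl⟩
  -- `D` is the total factor of `t` in `measure_not_eventually_le`, so `t = 1 / ((k + 1) * D)`
  -- yields the error `1 / (k + 1)`.
  set D : ℝ := 45 * (B : ℝ) ^ 8 + 1 + 1 + 1 with hD
  have hD0 : 0 < D := by positivity
  have h : ∀ k : ℕ, ∀ᵐ p ∂((Vilenkin.haar m).prod (Vilenkin.haar m)),
      ∀ᶠ n in atTop, ‖Vilenkin.marcinkiewiczFejer m f n p.1 p.2 - f p‖ ≤ 1 / ((k : ℝ) + 1) :=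
    fun k => by
      have := Vilenkin.measure_not_eventually_le hB' hf (t := 1 / ((k : ℝ) + 1) / D)
        (by positivity)
      refine (ae_iff.mpr this).mono fun p hp => hp.mono fun n hn => hn.trans_eq ?_
      have h1 : (45 * (B : ℝ) ^ 8 + 1) * (1 / ((k : ℝ) + 1) / D) + 1 / ((k : ℝ) + 1) / D +
          1 / ((k : ℝ) + 1) / D = D * (1 / ((k : ℝ) + 1) / D) := by
        rw [hD]
        ring
      rw [h1, mul_div_cancel₀ _ hD0.ne']
  rw [← ae_all_iff] at h
  filter_upwards [h] with p hp
  rw [tendsto_iff_norm_sub_tendsto_zero, Metric.tendsto_nhds]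
  intro ε hε
  obtain ⟨k, hk⟩ := exists_nat_one_div_lt hε
  filter_upwards [hp k] with n hn
  rw [dist_zero_right, norm_norm]
  exact hn.trans_lt hk
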